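/- Let $X$ be a compact complex manifold of dimension $n$ with a Kähler form $\omega$ (a smooth, closed, positive real $(1,1)$-form; for example the curvature of a positively curved Hermitian metric on a holomorphic line bundle). Let $$\mathcal H_\omega=\{\phi\in C^\infty(X,\mathbb R):\ \omega_\phi:=\omega+i\partial\bar\partial\phi>0\},$$ an open subset of the Fréchet space $C^\infty(X,\mathbb R)$, so that every tangent space $T_\phi\mathcal H_\omega$ is identified with $C^\infty(X,\mathbb R)$. For $\phi\in\mathcal H_\omega$ and $\xi_1,\xi_2,\xi_3\in T_\phi\mathcal H_\omega$ put $$\theta_\phi(\xi_1,\xi_2,\xi_3)=\int_X\{\xi_1,\xi_2\}_{\omega_\phi}\,\xi_3\,\omega_\phi^n ,$$ where $\{f,g\}_{\omega_\phi}=\omega_\phi(X_f,X_g)$, with $\iota_{X_f}\omega_\phi=df$, is the Poisson bracket of the symplectic form $\omega_\phi$. Then: (a) $\theta$ is a smooth three-form on $\mathcal H_\omega$. That is, for each $\phi\in\mathcal H_\omega$ the map $\theta_\phi$ is trilinear and skew-symmetric (alternating) on $C^\infty(X,\mathbb R)$, and $\theta$ is smooth along smooth curves: whenever $\phi_t,\xi_{1,t},\xi_{2,t},\xi_{3,t}$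 ($t\in\mathbb R$) are families of functions on $X$ that are $C^\infty$ jointly on $\mathbb R\times X$, the function $t\mapsto\theta_{\phi_t}(\xi_{1,t},\xi_{2,t},\xi_{3,t})$ is $C^\infty$ near every $t$ with $\phi_t\in\mathcal H_\omega$. (b) $\theta$ is $d$-closed: for all $\phi\in\mathcal H_\omega$ and $\xi_0,\dots,\xi_3\in C^\infty(X,\mathbb R)$, $$d\theta_\phi(\xi_0,\xi_1,\xi_2,\xi_3):=\sum_{j=0}^3(-1)^j\,\frac{d}{dt}\Big|_{t=0}\theta_{\phi+t\xi_j}(\xi_0,\dots,\widehat{\xi_j},\dots,\xi_3)=0 .$$ -/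

import Mathlib

open scoped Manifold ContDiff Topology
open MeasureTheory

noncomputable section

namespace KahlerPotentials

/-! ### Linear algebra of two-forms -/

section LinearAlgebra

variable {V : Type*} [AddCommGroup V] [Module ℝ V] [TopologicalSpace V]

/-- The vector `v` with `ι_v η = α`, i.e. `η(v, w) = α(w)` for all `w`. It exists and is unique
when `η` is nondegenerate and `V` is finite dimensional. -/
def hamiltonianVector (η : V [⋀^Fin 2]→L[ℝ] ℝ) (α : V →L[ℝ] ℝ) : V :=
  Classical.epsilon fun v : V => ∀ w : V, η ![v, w] = α w

/-- The multilinear form `v ↦ ∏ j, η(v (j, 0), v (j, 1))` in `2n` vectors. -/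
def pairProduct (n : ℕ) (η : V [⋀^Fin 2]→L[ℝ] ℝ) :
    MultilinearMap ℝ (fun _ : Fin n × Fin 2 => V) ℝ where
  toFun v := ∏ j, η fun k => v (j, k)
  map_update_add' := by
    intro hdec v i x y
    obtain ⟨j, k⟩ := i
    have hcur : ∀ z : V, ∀ l, (fun k' => Function.update v (j, k) z (l, k')) =
        if l = j then Function.update (fun k' => v (j, k')) k z else fun k' => v (l, k') := by
      intro z l
      funext k'
      by_cases hl : l = j
      · subst hl
        by_cases hk : k' = k
        · subst hk; simp
        · simp [Function.update_of_ne, hk]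
      · simp [hl, Function.update_of_ne]
    simp only [hcur]
    simp only [apply_ite (fun u : Fin 2 → V => η u)]
    simp only [Finset.prod_ite, Finset.filter_eq', Finset.mem_univ, if_true,
      Finset.prod_singleton]
    rw [η.map_update_add, add_mul]
  map_update_smul' := by
    intro hdec v i c x
    obtain ⟨j, k⟩ := i
    have hcur : ∀ z : V, ∀ l, (fun k' => Function.update v (j, k) z (l, k')) =
        if l = j then Function.update (fun k' => v (j, k')) k z else fun k' => v (l, k') := by
      intro z l
      funext k'
      by_cases hl : l = j
      · subst hl
        by_cases hk : k' = k
        · subst hk; simp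
        · simp [Function.update_of_ne, hk]
      · simp [hl, Function.update_of_ne]
    simp only [hcur]
    simp only [apply_ite (fun u : Fin 2 → V => η u)]
    simp only [Finset.prod_ite, Finset.filter_eq', Finset.mem_univ, if_true,
      Finset.prod_singleton]
    rw [η.map_update_smul, smul_eq_mul, smul_eq_mul, mul_assoc]

/-- The `n`-fold exterior power `η^n = η ∧ ⋯ ∧ η` of a two-form, a form in `2n` vectors indexed by
`Fin n × Fin 2` (ordered lexicographically):
`η^n(v) = 2⁻ⁿ ∑_σ sign σ ∏ j, η(v (σ (j, 0)), v (σ (j, 1)))`. -/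
def wedgePow (n : ℕ) (η : V [⋀^Fin 2]→L[ℝ] ℝ) : V [⋀^Fin n × Fin 2]→ₗ[ℝ] ℝ :=
  ((2 : ℝ) ^ n)⁻¹ • MultilinearMap.alternatization (pairProduct n η)

end LinearAlgebra

/-! ### Forms on complex manifolds -/

/-- The model space `ℂⁿ`. -/
abbrev Cn (n : ℕ) : Type := Fin n → ℂ

/-- Multiplication by `i` on `ℂⁿ`, as a real-linear map. -/
def mulI (n : ℕ) : Cn n →L[ℝ] Cn n :=
  (Complex.I • ContinuousLinearMap.id ℂ (Cn n)).restrictScalars ℝ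

/-- The frame `e₁, i e₁, …, eₙ, i eₙ` of `ℂⁿ`, which spans a cell of unit volume and is positive
for the complex orientation. -/
def stdFrame (n : ℕ) : Fin n × Fin 2 → Cn n :=
  fun jk => Pi.single jk.1 (![1, Complex.I] jk.2)

/-- The real one-form `d^c f = -df ∘ i = i(∂̄f - ∂f)` of a real function on `ℂⁿ`. -/
def dc {n : ℕ} (f : Cn n → ℝ) (y : Cn n) : Cn n [⋀^Fin 1]→L[ℝ] ℝ :=
  ContinuousAlternatingMap.ofSubsingleton ℝ (Cn n) ℝ (0 : Fin 1) (-(fderiv ℝ f y ∘L mulI n))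

/-- `i∂∂̄f = ½ d d^c f` for a real function on `ℂⁿ`. -/
def iddbarCn {n : ℕ} (f : Cn n → ℝ) (y : Cn n) : Cn n [⋀^Fin 2]→L[ℝ] ℝ :=
  (2 : ℝ)⁻¹ • extDeriv (dc f) y

section Manifold

variable (n : ℕ) (X : Type*) [TopologicalSpace X] [ChartedSpace (Cn n) X]

/-- A complex manifold is a real smooth manifold, with the same charts. -/
theorem isManifold_real [IsManifold 𝓘(ℂ, Cn n) ω X] : IsManifold 𝓘(ℝ, Cn n) ∞ X := by
  apply isManifold_of_contDiffOn
  intro e e' he he'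
  have h : e.symm ≫ₕ e' ∈ contDiffGroupoid ω 𝓘(ℂ, Cn n) :=
    HasGroupoid.compatible he he'
  rw [contDiffGroupoid, mem_groupoid_of_pregroupoid] at h
  have h3 : ContDiffOn ℂ ω (𝓘(ℂ, Cn n) ∘ (e.symm ≫ₕ e') ∘ 𝓘(ℂ, Cn n).symm)
    (𝓘(ℂ, Cn n).symm ⁻¹' (e.symm ≫ₕ e').source ∩ Set.range 𝓘(ℂ, Cn n)) := h.1
  exact (h3.restrict_scalars ℝ).of_le le_top

/-- `C^∞(X, ℝ)`. -/
abbrev SmoothFn : Type _ := C^∞⟮𝓘(ℝ, Cn n), X; 𝓘(ℝ, ℝ), ℝ⟯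

/-- Real two-forms on `X` (no regularity). Recall that `TangentSpace 𝓘(ℝ, Cn n) x` is `ℂⁿ`, the
identification being by the differential of the chart `chartAt (Cn n) x`. -/
abbrev TwoForm : Type _ := ∀ x : X, TangentSpace 𝓘(ℝ, Cn n) x [⋀^Fin 2]→L[ℝ] ℝ

/-- Real forms of top degree `2n` on `X` (no regularity). -/
abbrev TopForm : Type _ := ∀ x : X, TangentSpace 𝓘(ℝ, Cn n) x [⋀^Fin n × Fin 2]→ₗ[ℝ] ℝ

variable {n X}

/-- The complex structure `J` on the tangent spaces. -/
def J (x : X) : TangentSpace 𝓘(ℝ, Cn n) x →L[ℝ] TangentSpace 𝓘(ℝ, Cn n) x := mulI n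

/-- The differential of the inverse of a chart `e` at a point of `ℂⁿ`. -/
def chartFrame (e : OpenPartialHomeomorph X (Cn n)) (y : Cn n) :
    Cn n →L[ℝ] TangentSpace 𝓘(ℝ, Cn n) (e.symm y) :=
  mfderiv 𝓘(ℝ, Cn n) 𝓘(ℝ, Cn n) e.symm y

/-- The two-form `(e⁻¹)^* η` on the target of a chart `e`. -/
def TwoForm.inChart (η : TwoForm n X) (e : OpenPartialHomeomorph X (Cn n)) (y : Cn n) :
    Cn n [⋀^Fin 2]→L[ℝ] ℝ :=
  (η (e.symm y)).compContinuousLinearMap (chartFrame e y)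

/-- Positivity of a real `(1,1)`-form: `η(v, Jv) > 0` for `v ≠ 0`. -/
def TwoForm.IsPositive (η : TwoForm n X) : Prop :=
  ∀ (x : X) (v : TangentSpace 𝓘(ℝ, Cn n) x), v ≠ 0 → 0 < η x ![v, J x v]

/-- A Kähler form: a smooth closed positive real `(1,1)`-form. -/
structure IsKahlerForm (η : TwoForm n X) : Prop where
  smooth : ∀ e ∈ atlas (Cn n) X, ContDiffOn ℝ ∞ (η.inChart e) e.target
  closed : ∀ e ∈ atlas (Cn n) X, ∀ y ∈ e.target, extDeriv (η.inChart e) y = 0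
  type_one_one : ∀ (x : X) (v w : TangentSpace 𝓘(ℝ, Cn n) x), η x ![J x v, J x w] = η x ![v, w]
  positive : η.IsPositive

/-- The two-form `i∂∂̄φ` on `X`, computed at `x` in the holomorphic chart at `x`. -/
def iddbar (φ : SmoothFn n X) : TwoForm n X := fun x =>
  iddbarCn (fun y => φ ((chartAt (Cn n) x).symm y)) (chartAt (Cn n) x x)

/-- `ω_φ = ω + i∂∂̄φ`. -/
def perturbed (η : TwoForm n X) (φ : SmoothFn n X) : TwoForm n X := fun x => η x + iddbar φ x

/-- The space of Kähler potentials `H_ω = {φ ∈ C^∞(X, ℝ) : ω + i∂∂̄φ > 0}`. -/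
def potentials (η : TwoForm n X) : Set (SmoothFn n X) := {φ | (perturbed η φ).IsPositive}

/-- The Poisson bracket `{f, g}_η = η(X_f, X_g)`, where `ι_{X_f} η = df`. -/
def poissonBracket (η : TwoForm n X) (f g : SmoothFn n X) (x : X) : ℝ :=
  η x ![hamiltonianVector (η x) (mfderiv 𝓘(ℝ, Cn n) 𝓘(ℝ, ℝ) f x),
    hamiltonianVector (η x) (mfderiv 𝓘(ℝ, Cn n) 𝓘(ℝ, ℝ) g x)]

/-! ### Integration of top forms -/

section Integral

variable [IsManifold 𝓘(ℂ, Cn n) ω X] [CompactSpace X] [T2Space X]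

variable (n X) in
theorem exists_chartPartition : ∃ ρ : SmoothPartitionOfUnity X 𝓘(ℝ, Cn n) X Set.univ,
    ρ.IsSubordinate fun x => (chartAt (Cn n) x).source :=
  haveI : IsManifold 𝓘(ℝ, Cn n) ∞ X := isManifold_real n X
  SmoothPartitionOfUnity.exists_isSubordinate_chartAt_source 𝓘(ℝ, Cn n) X

variable (n X) in
/-- A smooth partition of unity subordinate to the preferred charts. -/
def chartPartition : SmoothPartitionOfUnity X 𝓘(ℝ, Cn n) X Set.univ :=
  (exists_chartPartition n X).choose

/-- The integral `∫_X η` of a top form over `X` with its complex orientation: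
`∑ c, ∫_{e_c(U_c)} (e_c⁻¹)^* (ρ_c η)` for charts `e_c : U_c → ℂⁿ` and a partition of unity `ρ_c`
subordinate to the `U_c` (by compactness only finitely many `ρ_c` are nonzero). -/
def integralTop (η : TopForm n X) : ℝ :=
  ∑ᶠ c : X, ∫ y in (chartAt (Cn n) c).target,
    chartPartition n X c ((chartAt (Cn n) c).symm y) *
      η ((chartAt (Cn n) c).symm y)
        (fun k => chartFrame (chartAt (Cn n) c) y (stdFrame n k))

/-- `θ_φ(ξ₁, ξ₂, ξ₃) = ∫_X {ξ₁, ξ₂}_{ω_φ} ξ₃ ω_φⁿ`. -/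
def theta (η : TwoForm n X) (φ : SmoothFn n X) (ξ : Fin 3 → SmoothFn n X) : ℝ :=
  integralTop fun x =>
    (poissonBracket (perturbed η φ) (ξ 0) (ξ 1) x * ξ 2 x) • wedgePow n (perturbed η φ x)

end Integral

/-! ### Differential forms on open sets of the Fréchet space `C^∞(X, ℝ)` -/

/-- A smooth curve in `C^∞(X, ℝ)`: one that is smooth jointly on `ℝ × X`. -/
def IsSmoothCurve (c : ℝ → SmoothFn n X) : Prop :=
  ContMDiff (𝓘(ℝ, ℝ).prod 𝓘(ℝ, Cn n)) 𝓘(ℝ, ℝ) ∞ fun p : ℝ × X => c p.1 p.2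

/-- `β` is a smooth differential `k`-form on `U ⊆ C^∞(X, ℝ)`, all tangent spaces being
`C^∞(X, ℝ)`: an alternating multilinear form at each point of `U`, depending smoothly on the point
and the vectors. Smoothness on a Fréchet space is smoothness along smooth curves. -/
structure IsSmoothForm (k : ℕ) (U : Set (SmoothFn n X))
    (β : SmoothFn n X → (Fin k → SmoothFn n X) → ℝ) : Prop where
  alternating : ∀ φ ∈ U, ∃ A : SmoothFn n X [⋀^Fin k]→ₗ[ℝ] ℝ, ∀ ξ, A ξ = β φ ξ
  smooth : ∀ (c : ℝ → SmoothFn n X) (ξ : Fin k → ℝ → SmoothFn n X),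
    IsSmoothCurve c → (∀ j, IsSmoothCurve (ξ j)) →
      ∀ t, c t ∈ U → ContDiffAt ℝ ∞ (fun s => β (c s) fun j => ξ j s) t

/-- The exterior derivative of a `k`-form on an open set of `C^∞(X, ℝ)`:
`dβ_φ(ξ₀, …, ξ_k) = ∑ j, (-1)^j D_{ξ_j} β_φ(ξ₀, …, ξ̂_j, …, ξ_k)`, with
`D_ξ` the derivative at `φ` in direction `ξ`. -/
def extDerivForm {k : ℕ} (β : SmoothFn n X → (Fin k → SmoothFn n X) → ℝ)
    (φ : SmoothFn n X) (ξ : Fin (k + 1) → SmoothFn n X) : ℝ :=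
  ∑ j : Fin (k + 1), (-1 : ℝ) ^ (j : ℕ) *
    deriv (fun t : ℝ => β (φ + t • ξ j) fun i => ξ (j.succAbove i)) 0

end Manifold

end KahlerPotentials

end

noncomputable section

namespace KahlerPotentials

/-! ### Derivatives of functions on a normed space -/

section Derivatives

variable {T : Type*} [NormedAddCommGroup T] [NormedSpace ℝ T] {P : T → ℝ}

/-! Pointwise, `{f, g} ω_φ^n = n df ∧ dg ∧ ω_φ^(n-1)`, so `θ_φ(f, g, h) = n ∫ h df ∧ dg ∧
ω_φ^(n-1)`. This is visibly skew in `f, g` and linear in `h`. Stokes applied to the exact form `df ∧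
d(gh) ∧ ω_φ^(n-1)` gives skewness in `g, h`, hence all of (a) except smoothness
(`chartIntegral_bracketDensity_swap`).

For (b), the derivative in the direction `ψ` is `n(n-1) ∫ h df ∧ dg ∧ i∂∂̄ψ ∧ ω_φ^(n-2)`. Since
`i∂∂̄ψ = d(½ d^c ψ)` and `ω_φ` is closed, integration by parts turns it into minus the integral of
`n(n-1) dh ∧ ½ d^c ψ ∧ df ∧ dg ∧ ω_φ^(n-2)` (`chartIntegral_variationDensity`). The alternating sum
of four such integrands vanishes pointwise. Indeed `Q(a, b, c, d) = a ∧ b ∧ c ∧ d ∧ ω_φ^(n-2)` is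
invariant under multiplication of vectors by unit complex numbers, because `ω_φ` is of type (1,1);
infinitesimally, `Q(Ja, b, c, d) + ⋯ + Q(a, b, c, Jd) = 0`, and this is the required sum up to a
factor (`quartic_alternating_sum`).

Wedge products of higher degree are replaced by calculus on the vector space of two-forms. The
coefficient `volCoeff` of `η^n` is a polynomial in `η`, and its derivatives `dVol` and `ddVol` play
the roles of `n η^(n-1)` and `n(n-1) η^(n-2)`. The one algebraic fact needed is `ddVol_wedge_left`,
which expresses `a ∧ b ∧ a ∧ c = 0`. Exterior derivatives become divergences in charts
(`sum_deriv_dVol`, `sum_deriv_ddVol`), and Stokes becomes `chartIntegral_divergence`.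

The same local formula gives smoothness: it is smooth in all data, and it computes `θ` wherever
`ω_φ` is nondegenerate, which persists for nearby parameters by compactness (`eventually_nondeg`).
-/

theorem hasDerivAt_add_smul (η δ : T) (t : ℝ) : HasDerivAt (fun s : ℝ => η + s • δ) δ t := by
  simpa using ((hasDerivAt_id t).smul_const δ).const_add η

theorem hasDerivAt_along_line (hP : Differentiable ℝ P) (η δ : T) (t : ℝ) :
    HasDerivAt (fun s : ℝ => P (η + s • δ)) (fderiv ℝ P (η + t • δ) δ) t :=
  (hP _).hasFDerivAt.comp_hasDerivAt t (hasDerivAt_add_smul η δ t)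

theorem fderiv_of_affine_on_line (hP : Differentiable ℝ P) {η δ : T} {a b : ℝ}
    (h : ∀ t : ℝ, P (η + t • δ) = a + t * b) (t : ℝ) : fderiv ℝ P (η + t • δ) δ = b := by
  have h1 := hasDerivAt_along_line hP η δ t
  rw [funext h] at h1
  refine h1.unique ?_
  simpa using ((hasDerivAt_id t).mul_const b).const_add a

/-- The first derivative in the direction `δ` is constant along the line, so differentiating it once
more along the line gives zero. -/
theorem fderiv_fderiv_of_affine_on_line (hP : ContDiff ℝ 2 P) {η δ : T} {a b : ℝ}
    (h : ∀ t : ℝ, P (η + t • δ) = a + t * b) : fderiv ℝ (fderiv ℝ P) η δ δ = 0 := by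
  have hd : Differentiable ℝ (fderiv ℝ P) :=
    (hP.fderiv_right (m := 1) (by norm_num)).differentiable (by norm_num)
  have h0 : HasDerivAt (fun s : ℝ => fderiv ℝ P (η + s • δ))
      (fderiv ℝ (fderiv ℝ P) (η + (0 : ℝ) • δ) δ) 0 :=
    (hd _).hasFDerivAt.comp_hasDerivAt (0 : ℝ) (hasDerivAt_add_smul η δ 0)
  have h1 := h0.clm_apply (hasDerivAt_const (0 : ℝ) δ)
  simp only [fderiv_of_affine_on_line (hP.differentiable (by norm_num)) h, zero_smul, add_zero,
    map_zero] at h1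
  exact h1.unique (hasDerivAt_const _ _)

/-- Chain rule on both sides of `P ∘ L = c P`. In the application `P` is the top power, `L` a
pullback and `c` a determinant, so the derivatives of the top power also transform as densities. -/
theorem fderiv_of_semiinvariant (hP : Differentiable ℝ P) {L : T →L[ℝ] T} {c : ℝ}
    (h : ∀ η, P (L η) = c * P η) (η δ : T) : fderiv ℝ P (L η) (L δ) = c * fderiv ℝ P η δ := by
  have h1 : HasFDerivAt (fun η => P (L η)) (fderiv ℝ P (L η) ∘L L) η :=
    (hP _).hasFDerivAt.comp η L.hasFDerivAt
  rw [funext h] at h1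
  exact congrArg (fun f : T →L[ℝ] ℝ => f δ) (h1.unique ((hP η).hasFDerivAt.const_mul c))

theorem fderiv_fderiv_of_semiinvariant (hP : ContDiff ℝ 2 P) {L : T →L[ℝ] T} {c : ℝ}
    (h : ∀ η, P (L η) = c * P η) (η δ ε : T) :
    fderiv ℝ (fderiv ℝ P) (L η) (L δ) (L ε) = c * fderiv ℝ (fderiv ℝ P) η δ ε := by
  have hd : Differentiable ℝ (fderiv ℝ P) :=
    (hP.fderiv_right (m := 1) (by norm_num)).differentiable (by norm_num)
  have key : ∀ ε : T, HasFDerivAt (fun η => fderiv ℝ P η ε)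
      ((fderiv ℝ (fderiv ℝ P) η).flip ε) η := fun ε => by
    simpa using (hd η).hasFDerivAt.clm_apply (hasFDerivAt_const ε η)
  have h1 : HasFDerivAt (fun η => fderiv ℝ P (L η) (L ε))
      ((fderiv ℝ (fderiv ℝ P) (L η) ∘L L).flip (L ε)) η := by
    simpa using ((hd (L η)).hasFDerivAt.comp η L.hasFDerivAt).clm_apply
      (hasFDerivAt_const (L ε) η)
  simp only [fderiv_of_semiinvariant (hP.differentiable (by norm_num)) h] at h1
  exact congrArg (fun f : T →L[ℝ] ℝ => f δ) (h1.unique ((key ε).const_mul c))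

end Derivatives

/-! ### The top power of a two-form on `ℂⁿ` -/

section TopPower

variable {n : ℕ}

/-- Real covectors on `ℂⁿ`. -/
abbrev Cov (n : ℕ) : Type := Cn n →L[ℝ] ℝ

/-- Real two-forms on the vector space `ℂⁿ`. -/
abbrev Two (n : ℕ) : Type := Cn n [⋀^Fin 2]→L[ℝ] ℝ

instance : NormedAddCommGroup (Two n) := inferInstance
instance : NormedSpace ℝ (Two n) := inferInstance
instance : NormedAddCommGroup (Two n →L[ℝ] ℝ) := inferInstance
instance : NormedSpace ℝ (Two n →L[ℝ] ℝ) := inferInstance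
instance : NormedAddCommGroup (Cov n →L[ℝ] Two n) := inferInstance
instance : NormedSpace ℝ (Cov n →L[ℝ] Two n) := inferInstance
instance : NormedAddCommGroup (Two n →L[ℝ] Two n →L[ℝ] ℝ) := inferInstance
instance : NormedSpace ℝ (Two n →L[ℝ] Two n →L[ℝ] ℝ) := inferInstance

/-- The wedge product `α ∧ β` of two covectors. -/
def wedgeCov (α β : Cov n) : Two n where
  toFun v := α (v 0) * β (v 1) - β (v 0) * α (v 1)
  map_update_add' v i x y := by
    fin_cases i <;> simp <;> ring
  map_update_smul' v i c x := by
    fin_cases i <;> simp <;> ring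
  map_eq_zero_of_eq' v i j h hij := by
    fin_cases i <;> fin_cases j <;> simp_all <;> ring
  cont := by fun_prop

@[simp] theorem wedgeCov_apply (α β : Cov n) (v : Fin 2 → Cn n) :
    wedgeCov α β v = α (v 0) * β (v 1) - β (v 0) * α (v 1) := rfl

theorem two_ext {η η' : Two n} (h : ∀ v w, η ![v, w] = η' ![v, w]) : η = η' := by
  ext v
  have : v = ![v 0, v 1] := by ext i; fin_cases i <;> rfl
  rw [this]; exact h _ _

/-- The wedge product of covectors as a continuous bilinear map. -/
def wedge : Cov n →L[ℝ] Cov n →L[ℝ] Two n :=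
  LinearMap.toContinuousBilinearMap <| LinearMap.mk₂ ℝ wedgeCov
    (fun a b c => two_ext fun v w => by simp; ring)
    (fun r b c => two_ext fun v w => by simp; ring)
    (fun a b c => two_ext fun v w => by simp; ring)
    (fun r b c => two_ext fun v w => by simp; ring)

theorem wedge_apply (α β : Cov n) (v : Fin 2 → Cn n) :
    wedge α β v = α (v 0) * β (v 1) - β (v 0) * α (v 1) := rfl

theorem wedge_swap (α β : Cov n) : wedge α β = - wedge β α :=
  two_ext fun v w => by simp [wedge_apply]

/-- Pullback of two-forms by a linear map. -/
abbrev pull (L : Cn n →L[ℝ] Cn n) : Two n →L[ℝ] Two n :=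
  ContinuousAlternatingMap.compContinuousLinearMapCLM L

theorem pull_apply (L : Cn n →L[ℝ] Cn n) (η : Two n) (v : Fin 2 → Cn n) :
    pull L η v = η (fun i => L (v i)) := rfl

theorem pull_apply_pair (L : Cn n →L[ℝ] Cn n) (η : Two n) (v w : Cn n) :
    pull L η ![v, w] = η ![L v, L w] := by
  rw [pull_apply]; congr 1; ext i; fin_cases i <;> rfl

theorem pull_wedge (L : Cn n →L[ℝ] Cn n) (α β : Cov n) :
    pull L (wedge α β) = wedge (α ∘L L) (β ∘L L) := rfl

theorem two_swap (η : Two n) (v w : Cn n) : η ![v, w] = - η ![w, v] := by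
  have := η.map_swap ![v, w] (i := 0) (j := 1) (by decide)
  change η (![v, w] ∘ Equiv.swap 0 1) = - η ![v, w] at this
  rw [← neg_eq_iff_eq_neg, ← this]
  congr 1; ext i; fin_cases i <;> simp

theorem two_self (η : Two n) (v : Cn n) : η ![v, v] = 0 :=
  η.map_eq_zero_of_eq _ (i := 0) (j := 1) rfl (by decide)

theorem two_add_left (η : Two n) (v v' w : Cn n) : η ![v + v', w] = η ![v, w] + η ![v', w] :=
  congrFun (congrArg DFunLike.coe (η.curryLeft.map_add v v')) ![w]

theorem two_smul_left (η : Two n) (r : ℝ) (v w : Cn n) : η ![r • v, w] = r * η ![v, w] :=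
  congrFun (congrArg DFunLike.coe (η.curryLeft.map_smul r v)) ![w]

theorem two_add_right (η : Two n) (v w w' : Cn n) : η ![v, w + w'] = η ![v, w] + η ![v, w'] := by
  rw [two_swap, two_add_left, neg_add, ← two_swap, ← two_swap]

theorem two_smul_right (η : Two n) (r : ℝ) (v w : Cn n) : η ![v, r • w] = r * η ![v, w] := by
  rw [two_swap, two_smul_left, ← mul_neg, ← two_swap]

/-- The basis `e₁, i e₁, …, eₙ, i eₙ` of `ℂⁿ`. -/
def stdBasis (n : ℕ) : Module.Basis (Fin n × Fin 2) ℝ (Cn n) :=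
  (Pi.basis fun _ : Fin n => Complex.basisOneI).reindex (Equiv.sigmaEquivProd _ _)

theorem coe_stdBasis : ⇑(stdBasis n) = stdFrame n := by
  funext ⟨j, k⟩
  simp [stdBasis, stdFrame, Pi.basis_apply]

/-- The dual basis of covectors. -/
def dualCov (i : Fin n × Fin 2) : Cov n := LinearMap.toContinuousLinearMap ((stdBasis n).coord i)

theorem sum_dualCov (α : Cov n) : ∑ i, α (stdBasis n i) • dualCov i = α := by
  ext v
  have := congrArg α ((stdBasis n).sum_repr v)
  rw [← this]
  simp [dualCov, mul_comm, -Module.Basis.sum_repr]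

/-- The factor `2⁻¹` is there because the double sum runs over ordered pairs. -/
theorem sum_smul_wedge (δ : Two n) : (2 : ℝ)⁻¹ • ∑ i, ∑ j,
    δ ![stdBasis n i, stdBasis n j] • wedge (dualCov i) (dualCov j) = δ := by
  refine two_ext fun v w => ?_
  have key : ∀ v w, δ ![v, w] = ∑ i, ∑ j, δ ![stdBasis n i, stdBasis n j] *
      ((stdBasis n).repr v i * (stdBasis n).repr w j) := by
    intro v w
    have h1 : ∀ v w, δ ![v, w] = ∑ i, (stdBasis n).repr v i * δ ![stdBasis n i, w] := by
      intro v w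
      let ℓ : Cn n →ₗ[ℝ] ℝ :=
        { toFun := fun v => δ ![v, w]
          map_add' := fun a b => two_add_left _ _ _ _
          map_smul' := fun a b => two_smul_left _ _ _ _ }
      change ℓ v = ∑ i, (stdBasis n).repr v i * ℓ (stdBasis n i)
      rw [← congrArg ℓ ((stdBasis n).sum_repr v)]
      simp [-Module.Basis.sum_repr]
    rw [h1 v w]
    refine Finset.sum_congr rfl fun i _ => ?_
    rw [two_swap, h1, ← Finset.sum_neg_distrib, Finset.mul_sum]
    refine Finset.sum_congr rfl fun j _ => ?_
    rw [two_swap δ (stdBasis n j)]; ring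
  have e : ((2 : ℝ)⁻¹ • ∑ i, ∑ j, δ ![stdBasis n i, stdBasis n j] •
      wedge (dualCov i) (dualCov j)) ![v, w] = (2 : ℝ)⁻¹ * (δ ![v, w] - δ ![w, v]) := by
    rw [key v w, key w v]
    simp only [ContinuousAlternatingMap.smul_apply, ContinuousAlternatingMap.sum_apply,
      wedge_apply, smul_eq_mul, ← Finset.sum_sub_distrib]
    congr 1
    refine Finset.sum_congr rfl fun i _ => Finset.sum_congr rfl fun j _ => ?_
    simp [dualCov]; ring
  rw [e, two_swap δ w v]; ring

variable (n) in
/-- The coefficient of `η^n` in the standard frame. -/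
def volCoeff (η : Two n) : ℝ := wedgePow n η (stdFrame n)

theorem wedgePow_apply (η : Two n) (v : Fin n × Fin 2 → Cn n) :
    wedgePow n η v = ((2 : ℝ) ^ n)⁻¹ * ∑ σ : Equiv.Perm (Fin n × Fin 2),
      Equiv.Perm.sign σ • ∏ j, η fun k => v (σ (j, k)) := by
  simp [wedgePow, MultilinearMap.alternatization_apply, pairProduct]

theorem contDiff_volCoeff : ContDiff ℝ ∞ (volCoeff n) := by
  have h : volCoeff n = fun η : Two n => ((2 : ℝ) ^ n)⁻¹ * ∑ σ : Equiv.Perm (Fin n × Fin 2),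
      Equiv.Perm.sign σ • ∏ j, ContinuousAlternatingMap.apply ℝ (Cn n) ℝ
        (fun k => stdFrame n (σ (j, k))) η := by
    funext η; exact wedgePow_apply η _
  rw [h]
  refine contDiff_const.mul (ContDiff.sum fun σ _ => ?_)
  have : ContDiff ℝ ∞ fun η : Two n => ∏ j, ContinuousAlternatingMap.apply ℝ (Cn n) ℝ
        (fun k => stdFrame n (σ (j, k))) η :=
    contDiff_prod fun j _ => ContinuousLinearMap.contDiff _
  simpa [Units.smul_def] using contDiff_const.mul this

theorem wedgePow_pull (L : Cn n →L[ℝ] Cn n) (η : Two n) (v : Fin n × Fin 2 → Cn n) :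
    wedgePow n (pull L η) v = wedgePow n η (L ∘ v) := by
  simp only [wedgePow_apply, pull_apply, Function.comp_apply]

theorem wedgePow_apply_frame (L : Cn n →L[ℝ] Cn n) (η : Two n) :
    wedgePow n η (L ∘ stdFrame n) = L.det * volCoeff n η := by
  rw [AlternatingMap.eq_smul_basis_det (stdBasis n) (wedgePow n η), volCoeff, ← coe_stdBasis]
  simp only [AlternatingMap.smul_apply, smul_eq_mul]
  have := (stdBasis n).det_comp (L : Cn n →ₗ[ℝ] Cn n) (stdBasis n)
  rw [(stdBasis n).det_self, mul_one] at this
  change _ * (stdBasis n).det ((L : Cn n →ₗ[ℝ] Cn n) ∘ stdBasis n) = _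
  rw [this, mul_comm, ContinuousLinearMap.det]

theorem volCoeff_pull (L : Cn n →L[ℝ] Cn n) (η : Two n) :
    volCoeff n (pull L η) = L.det * volCoeff n η := by
  rw [volCoeff, wedgePow_pull, wedgePow_apply_frame]

variable (n) in
/-- The derivative of `η ↦ η^n`. -/
def dVol (η : Two n) : Two n →L[ℝ] ℝ := fderiv ℝ (volCoeff n) η

variable (n) in
/-- The second derivative of `η ↦ η^n`. -/
def ddVol (η : Two n) : Two n →L[ℝ] Two n →L[ℝ] ℝ := fderiv ℝ (dVol n) η

theorem contDiff_dVol : ContDiff ℝ ∞ (dVol n) := contDiff_volCoeff.fderiv_right (by simp)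

theorem contDiff_ddVol : ContDiff ℝ ∞ (ddVol n) := contDiff_dVol.fderiv_right (by simp)

theorem hasFDerivAt_dVol (η : Two n) : HasFDerivAt (dVol n) (ddVol n η) η :=
  (contDiff_dVol.differentiable (by simp) η).hasFDerivAt

theorem dVol_pull (L : Cn n →L[ℝ] Cn n) (η δ : Two n) :
    dVol n (pull L η) (pull L δ) = L.det * dVol n η δ :=
  fderiv_of_semiinvariant (contDiff_volCoeff.differentiable (by simp)) (volCoeff_pull L) η δ

theorem ddVol_pull (L : Cn n →L[ℝ] Cn n) (η δ ε : Two n) :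
    ddVol n (pull L η) (pull L δ) (pull L ε) = L.det * ddVol n η δ ε :=
  fderiv_fderiv_of_semiinvariant (contDiff_infty.1 contDiff_volCoeff 2) (volCoeff_pull L) η δ ε

theorem ddVol_symm (η δ ε : Two n) : ddVol n η δ ε = ddVol n η ε δ :=
  (contDiff_volCoeff.contDiffAt.isSymmSndFDerivAt
    (by rw [minSmoothness_of_isRCLikeNormedField]; exact WithTop.coe_le_coe.2 le_top)) δ ε

/-! ### Nondegenerate forms -/

/-- Nondegeneracy of a two-form. -/
def Nondeg (η : Two n) : Prop := ∀ v : Cn n, (∀ w, η ![v, w] = 0) → v = 0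

/-- The map `v ↦ ι_v η`, linear in `η`. -/
def contraction : Two n →L[ℝ] Cn n →L[ℝ] Cov n :=
  (ContinuousLinearMap.compL ℝ (Cn n) (Cn n [⋀^Fin 1]→L[ℝ] ℝ) (Cov n)
    (ContinuousAlternatingMap.ofSubsingletonLIE (𝕜 := ℝ) (E := Cn n) (F := ℝ)
      (0 : Fin 1)).symm.toContinuousLinearEquiv.toContinuousLinearMap) ∘L
  (ContinuousAlternatingMap.curryLeftLI (𝕜 := ℝ) (E := Cn n) (F := ℝ)
    (n := 1)).toContinuousLinearMap

theorem contraction_apply (η : Two n) (v w : Cn n) : contraction η v w = η ![v, w] := by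
  change η.curryLeft v (fun _ => w) = _
  rw [ContinuousAlternatingMap.curryLeft_apply_apply]
  congr 1; ext i; fin_cases i <;> rfl

/-- This form gives openness of nondegeneracy, since the invertible operators form an open set, and
also existence of Hamiltonian vectors. -/
theorem nondeg_iff (η : Two n) :
    Nondeg η ↔ contraction η ∈ Set.range ((↑) : (Cn n ≃L[ℝ] Cov n) → Cn n →L[ℝ] Cov n) := by
  constructor
  · intro h
    have hinj : Function.Injective (contraction η : Cn n →ₗ[ℝ] Cov n) := by
      rw [← LinearMap.ker_eq_bot, LinearMap.ker_eq_bot']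
      intro v hv
      exact h v fun w => by
        rw [← contraction_apply]
        exact congrArg (fun f : Cov n => f w) hv
    have hdim : Module.finrank ℝ (Cn n) = Module.finrank ℝ (Cov n) := by
      rw [← (LinearMap.toContinuousLinearMap (𝕜 := ℝ) (E := Cn n) (F' := ℝ)).finrank_eq]
      exact (Subspace.dual_finrank_eq (K := ℝ) (V := Cn n)).symm
    exact ⟨(LinearEquiv.ofInjectiveOfFinrankEq _ hinj hdim).toContinuousLinearEquiv, by
      ext v; rfl⟩
  · rintro ⟨e, he⟩ v hv
    have : e v = 0 := by
      ext w
      have := hv w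
      rw [← contraction_apply, ← he] at this
      exact this
    simpa using this

theorem isOpen_nondeg : IsOpen {η : Two n | Nondeg η} := by
  simp only [nondeg_iff]
  exact ContinuousLinearEquiv.isOpen.preimage contraction.continuous

theorem Nondeg.exists_hamiltonian {η : Two n} (h : Nondeg η) (α : Cov n) :
    ∃ v, ∀ w, η ![v, w] = α w := by
  obtain ⟨e, he⟩ := (nondeg_iff η).1 h
  refine ⟨e.symm α, fun w => ?_⟩
  rw [← contraction_apply, ← he]
  simp

/-- The form `η + α ∧ β` is the pullback of `η` by the transvection `v ↦ v + α(v) x`, the quadratic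
term dropping out because `η(x, x) = 0`. The determinant of the transvection is `1 + α(x)`. -/
theorem volCoeff_add_wedge {η : Two n} {α β : Cov n} {x : Cn n} (hx : ∀ w, η ![x, w] = β w) :
    volCoeff n (η + wedge α β) = (1 + α x) * volCoeff n η := by
  let L : Cn n →L[ℝ] Cn n := ContinuousLinearMap.id ℝ _ + α.smulRight x
  have hL : pull L η = η + wedge α β := by
    refine two_ext fun v w => ?_
    have e : ∀ v, L v = v + α v • x := fun v => rfl
    rw [pull_apply_pair, e, e, two_add_left, two_add_right, two_add_right, two_smul_left,
      two_smul_left, two_smul_right, two_smul_right, two_self, hx, two_swap η v x, hx]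
    simp [wedge_apply]; ring
  have hdet : L.det = 1 + α x := by
    have := LinearMap.transvection.det (α : Module.Dual ℝ (Cn n)) x
    rw [ContinuousLinearMap.det]
    refine Eq.trans ?_ this
    congr 1
  rw [← hL, volCoeff_pull, hdet]

theorem volCoeff_line {η : Two n} {α β : Cov n} {x : Cn n} (hx : ∀ w, η ![x, w] = β w) (t : ℝ) :
    volCoeff n (η + t • wedge α β) = volCoeff n η + t * (α x * volCoeff n η) := by
  have := volCoeff_add_wedge (α := t • α) hx
  rw [map_smul, _root_.smul_apply] at this
  rw [this, _root_.smul_apply, smul_eq_mul]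
  ring

theorem dVol_wedge {η : Two n} {α β : Cov n} {x : Cn n} (hx : ∀ w, η ![x, w] = β w) :
    dVol n η (wedge α β) = α x * volCoeff n η := by
  have := fderiv_of_affine_on_line (contDiff_volCoeff.differentiable (by simp))
    (volCoeff_line (α := α) hx) 0
  rwa [zero_smul, add_zero] at this

/-- The top power is affine along `η + t (α ∧ β)` once `β` is a contraction of `η`, which
nondegeneracy ensures. -/
theorem ddVol_wedge_self {η : Two n} (h : Nondeg η) (α β : Cov n) :
    ddVol n η (wedge α β) (wedge α β) = 0 := by
  obtain ⟨x, hx⟩ := h.exists_hamiltonian β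
  exact fderiv_fderiv_of_affine_on_line (contDiff_infty.1 contDiff_volCoeff 2) (volCoeff_line hx)

/-- Polarisation of `ddVol_wedge_self` in the second covector. This stands for `α ∧ β ∧ α ∧ γ ∧
η^(n-2) = 0`. -/
theorem ddVol_wedge_left {η : Two n} (h : Nondeg η) (α β γ : Cov n) :
    ddVol n η (wedge α β) (wedge α γ) = 0 := by
  have h1 := ddVol_wedge_self h α (β + γ)
  rw [map_add, map_add, map_add, add_apply, add_apply, ddVol_wedge_self h α β,
    ddVol_wedge_self h α γ] at h1
  have h2 := ddVol_symm η (wedge α β) (wedge α γ)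
  linarith

end TopPower

section Quartic

variable {n : ℕ}

/-! ### The alternating quartic form `(a, b, c, d) ↦ a ∧ b ∧ c ∧ d ∧ η^(n-2)` -/

/-- The value of `a ∧ b ∧ c ∧ d ∧ η^(n-2)`, up to a constant, in the standard frame. -/
def quartic (η : Two n) (a b c d : Cov n) : ℝ := ddVol n η (wedge a b) (wedge c d)

theorem quartic_swap_left (η : Two n) (a b c d : Cov n) :
    quartic η a b c d = - quartic η b a c d := by
  rw [quartic, wedge_swap, map_neg, neg_apply, quartic]

theorem quartic_swap_right (η : Two n) (a b c d : Cov n) :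
    quartic η a b c d = - quartic η a b d c := by
  rw [quartic, wedge_swap c d, map_neg, quartic]

/-- A bilinear form on two-forms that vanishes on pairs `(a ∧ b, a ∧ c)` changes sign when the first
factors are exchanged. -/
theorem wedge_exchange {q : Two n →L[ℝ] Two n →L[ℝ] ℝ}
    (hq : ∀ a b c : Cov n, q (wedge a b) (wedge a c) = 0) (a b c d : Cov n) :
    q (wedge a b) (wedge c d) = - q (wedge c b) (wedge a d) := by
  have h := hq (a + c) b d
  simp only [map_add, _root_.add_apply, hq] at h
  linarith

/-- Together with the two swaps this makes `quartic η` skew in all four arguments, since the three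
transpositions generate all permutations. -/
theorem quartic_exchange {η : Two n} (h : Nondeg η) (a b c d : Cov n) :
    quartic η a b c d = - quartic η c b a d :=
  wedge_exchange (ddVol_wedge_left h) a b c d

/-! ### Invariance under the complex structure -/

theorem det_restrictScalars (A : Cn n →L[ℂ] Cn n) :
    (A.restrictScalars ℝ).det = Complex.normSq (LinearMap.det (A : Cn n →ₗ[ℂ] Cn n)) := by
  rw [← Algebra.norm_complex_apply, ← LinearMap.det_restrictScalars]
  rfl

/-- Multiplication by the unit complex number `x + iy` preserves a form of type (1,1), and its real
determinant is `|(x + iy)^n|² = 1`. It therefore preserves `quartic η`, and it pulls a covector `a`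
back to `x a + y (a ∘ J)`. -/
theorem quartic_rotate {η : Two n} (hη : ∀ v w, η ![mulI n v, mulI n w] = η ![v, w])
    {x y : ℝ} (hxy : x ^ 2 + y ^ 2 = 1) (a b c d : Cov n) :
    quartic η (x • a + y • (a ∘L mulI n)) (x • b + y • (b ∘L mulI n))
      (x • c + y • (c ∘L mulI n)) (x • d + y • (d ∘L mulI n)) = quartic η a b c d := by
  let A : Cn n →L[ℂ] Cn n := ((x : ℂ) + y * Complex.I) • ContinuousLinearMap.id ℂ (Cn n)
  let L : Cn n →L[ℝ] Cn n := A.restrictScalars ℝ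
  have hL : ∀ v, L v = x • v + y • mulI n v := fun v => by
    ext i
    simp [L, A, mulI, add_mul, mul_assoc]
  have hII : ∀ v, mulI n (mulI n v) = -v := fun v => by
    ext i
    simp [mulI, ← mul_assoc]
  have hcomp : ∀ e : Cov n, x • e + y • (e ∘L mulI n) = e ∘L L := fun e => by
    ext v
    simp [hL]
  have hJ : ∀ v w, η ![mulI n v, w] = - η ![v, mulI n w] := fun v w => by
    rw [← hη (mulI n v) w, hII, ← neg_one_smul ℝ v, two_smul_left, neg_one_mul]
  have hpull : pull L η = η := by
    refine two_ext fun v w => ?_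
    rw [pull_apply_pair, hL, hL, two_add_left, two_add_right, two_add_right]
    simp only [two_smul_left, two_smul_right, hη, hJ]
    linear_combination (η ![v, w]) * hxy
  have hdet : L.det = 1 := by
    rw [det_restrictScalars]
    have : LinearMap.det (A : Cn n →ₗ[ℂ] Cn n) = ((x : ℂ) + y * Complex.I) ^ n := by
      change LinearMap.det (((x : ℂ) + y * Complex.I) • (LinearMap.id : Cn n →ₗ[ℂ] Cn n)) = _
      rw [LinearMap.det_smul]
      simp
    rw [this, map_pow, Complex.normSq_add_mul_I, hxy, one_pow]
  simp only [hcomp, quartic, ← pull_wedge]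
  have := ddVol_pull L η (wedge a b) (wedge c d)
  rwa [hpull, hdet, one_mul] at this

/-- Infinitesimal form of `quartic_rotate`, extracted from finitely many rotations instead of by
differentiation. -/
theorem quartic_derivation {η : Two n} (hη : ∀ v w, η ![mulI n v, mulI n w] = η ![v, w])
    (a b c d : Cov n) :
    quartic η (a ∘L mulI n) b c d + quartic η a (b ∘L mulI n) c d +
      quartic η a b (c ∘L mulI n) d + quartic η a b c (d ∘L mulI n) = 0 := by
  -- Half the difference of the invariance identities at `(x, y)` and `(x, -y)`: only odd powers of
  -- `y` survive.
  have key : ∀ x y : ℝ, x ^ 2 + y ^ 2 = 1 → x ^ 3 * y * (quartic η (a ∘L mulI n) b c d +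
      quartic η a (b ∘L mulI n) c d + quartic η a b (c ∘L mulI n) d +
      quartic η a b c (d ∘L mulI n)) + x * y ^ 3 * (quartic η a (b ∘L mulI n) (c ∘L mulI n)
        (d ∘L mulI n) + quartic η (a ∘L mulI n) b (c ∘L mulI n) (d ∘L mulI n) +
      quartic η (a ∘L mulI n) (b ∘L mulI n) c (d ∘L mulI n) +
      quartic η (a ∘L mulI n) (b ∘L mulI n) (c ∘L mulI n) d) = 0 := by
    intro x y hxy
    have h1 := quartic_rotate hη hxy a b c d
    have h2 := quartic_rotate hη (x := x) (y := -y) (by rw [neg_sq]; exact hxy) a b c d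
    simp only [quartic, map_add, map_smul, _root_.add_apply, _root_.smul_apply, smul_eq_mul]
      at h1 h2 ⊢
    linear_combination (h1 - h2) / 2
  -- Two rational points of the circle at which the coefficient vectors `(x³y, xy³)` are linearly
  -- independent, so both sums vanish.
  have h1 := key (3 / 5) (4 / 5) (by norm_num)
  have h2 := key (4 / 5) (3 / 5) (by norm_num)
  linarith

/-- The algebraic identity behind the closedness of `θ`. -/
theorem quartic_alternating_sum {η : Two n} (h : Nondeg η)
    (hη : ∀ v w, η ![mulI n v, mulI n w] = η ![v, w]) (a b c d : Cov n) :
    quartic η d (a ∘L mulI n) b c - quartic η d (b ∘L mulI n) a c +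
      quartic η d (c ∘L mulI n) a b - quartic η c (d ∘L mulI n) a b = 0 := by
  -- A cyclic shift of four arguments is an odd permutation.
  have key : ∀ a b c d : Cov n, quartic η d a b c = - quartic η a b c d := fun a b c d => by
    rw [quartic_exchange h, quartic_swap_left, neg_neg, quartic_swap_right]
  have := quartic_derivation hη a b c d
  rw [key (a ∘L mulI n), key (b ∘L mulI n), key (c ∘L mulI n), key (d ∘L mulI n),
    quartic_swap_left η (b ∘L mulI n), quartic_exchange h (c ∘L mulI n),
    quartic_swap_left η b, key a b c]
  linarith

end Quartic

/-! ### Divergence identities -/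

section Divergence

variable {n : ℕ}

theorem sum_symm_mul_antisymm {ι : Type*} [Fintype ι] {s t : ι → ι → ℝ}
    (hs : ∀ i j, s i j = s j i) (ht : ∀ i j, t i j = - t j i) : ∑ i, ∑ j, s i j * t i j = 0 := by
  have h : ∑ i, ∑ j, s i j * t i j = - ∑ i, ∑ j, s i j * t i j := by
    conv_lhs => rw [Finset.sum_comm]
    rw [← Finset.sum_neg_distrib]
    refine Finset.sum_congr rfl fun i _ => ?_
    rw [← Finset.sum_neg_distrib]
    refine Finset.sum_congr rfl fun j _ => ?_
    rw [hs j i, ht j i]; ring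
  linarith

theorem sum_closed_mul_cyclic {ι : Type*} [Fintype ι] {A S : ι → ι → ι → ℝ}
    (hA : ∀ i j k, A i j k + A j k i + A k i j = 0) (hS : ∀ i j k, S i j k = S j k i) :
    ∑ i, ∑ j, ∑ k, A i j k * S i j k = 0 := by
  have h1 : ∀ B : ι → ι → ι → ℝ, ∑ i, ∑ j, ∑ k, B j k i = ∑ i, ∑ j, ∑ k, B i j k := fun B => by
    rw [Finset.sum_comm]
    refine Finset.sum_congr rfl fun j _ => ?_
    rw [Finset.sum_comm]
  have h2 := h1 fun i j k => A i j k * S i j k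
  have h3 := h1 fun i j k => A j k i * S j k i
  have h4 : ∑ i, ∑ j, ∑ k, (A i j k * S i j k + A j k i * S j k i + A k i j * S k i j) = 0 := by
    refine Finset.sum_eq_zero fun i _ => Finset.sum_eq_zero fun j _ =>
      Finset.sum_eq_zero fun k _ => ?_
    rw [← hS i j k, hS k i j, ← add_mul, ← add_mul, hA, zero_mul]
  simp only [Finset.sum_add_distrib] at h4
  linarith

/-- Contraction of a closed form with a bilinear form vanishing on the pairs `(a ∧ b, a ∧ c)`. -/
theorem sum_closed_contraction {q : Two n →L[ℝ] Two n →L[ℝ] ℝ}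
    (hq : ∀ a b c : Cov n, q (wedge a b) (wedge a c) = 0) {W : Cn n → Two n} {y : Cn n}
    (hW : DifferentiableAt ℝ W y) (hc : extDeriv W y = 0) (α : Cov n) :
    ∑ i, q (fderiv ℝ W y (stdBasis n i)) (wedge (dualCov i) α) = 0 := by
  -- Closedness of `W`, written as the vanishing of the cyclic sum of its first derivatives.
  have hA : ∀ u v w, fderiv ℝ W y u ![v, w] + fderiv ℝ W y v ![w, u] + fderiv ℝ W y w ![u, v] = 0 := by
    intro u v w
    have h : extDeriv W y ![u, v, w] = ∑ i : Fin 3, (-1) ^ i.val •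
      fderiv ℝ (fun y => W y (i.removeNth ![u, v, w])) y (![u, v, w] i) := extDeriv_apply hW _
    rw [hc] at h
    have e : ∀ (p : Fin 2 → Cn n) (x : Cn n),
        fderiv ℝ (fun y => W y p) y x = fderiv ℝ W y x p := fun p x => by
      have := ((ContinuousAlternatingMap.apply ℝ (Cn n) ℝ p).hasFDerivAt.comp y hW.hasFDerivAt)
      rw [HasFDerivAt.fderiv (f := fun y => W y p) this]
      rfl
    simp only [Fin.sum_univ_three, e] at h
    have e0 : (0 : Fin 3).removeNth ![u, v, w] = ![v, w] := by
      ext i; fin_cases i <;> rfl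
    have e1 : (1 : Fin 3).removeNth ![u, v, w] = ![u, w] := by
      ext i; fin_cases i <;> rfl
    have e2 : (2 : Fin 3).removeNth ![u, v, w] = ![u, v] := by
      ext i; fin_cases i <;> rfl
    rw [e0, e1, e2] at h
    rw [two_swap _ w u]
    simp at h
    linarith
  have hsum : ∀ i, q (fderiv ℝ W y (stdBasis n i)) (wedge (dualCov i) α) = (2 : ℝ)⁻¹ * ∑ j, ∑ k,
      fderiv ℝ W y (stdBasis n i) ![stdBasis n j, stdBasis n k] *
        q (wedge (dualCov j) (dualCov k)) (wedge (dualCov i) α) := by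
    intro i
    conv_lhs => rw [← sum_smul_wedge (fderiv ℝ W y (stdBasis n i))]
    simp only [map_smul, map_sum, _root_.smul_apply, _root_.sum_apply, smul_eq_mul]
  simp only [hsum]
  rw [← Finset.mul_sum, sum_closed_mul_cyclic, mul_zero]
  · exact fun i j k => hA _ _ _
  -- The other factor is invariant under cyclic shifts of the three indices: a shift is one exchange
  -- followed by one swap, and the two signs cancel.
  · intro i j k
    rw [wedge_exchange hq, wedge_swap (dualCov i), map_neg, neg_apply, neg_neg]

/-- The Hessian is symmetric. -/
theorem fderiv_fderiv_symm {f : Cn n → ℝ} {y : Cn n} (hf : ContDiffAt ℝ 2 f y) (v w : Cn n) :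
    fderiv ℝ (fderiv ℝ f) y v w = fderiv ℝ (fderiv ℝ f) y w v :=
  hf.isSymmSndFDerivAt (by rw [minSmoothness_of_isRCLikeNormedField]) v w

/-- A symmetric Hessian is contracted with a skew form; this plays the role of `d(df) = 0`. -/
theorem sum_hessian_contraction {f : Cn n → ℝ} {y : Cn n} (hf : ContDiffAt ℝ 2 f y)
    {t : Cov n →L[ℝ] Cov n →L[ℝ] ℝ} (ht : ∀ a b, t a b = - t b a) :
    ∑ i, t (dualCov i) (fderiv ℝ (fderiv ℝ f) y (stdBasis n i)) = 0 := by
  have h : ∀ i, t (dualCov i) (fderiv ℝ (fderiv ℝ f) y (stdBasis n i)) =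
      ∑ j, fderiv ℝ (fderiv ℝ f) y (stdBasis n i) (stdBasis n j) *
        t (dualCov i) (dualCov j) := fun i => by
    conv_lhs => rw [← sum_dualCov (fderiv ℝ (fderiv ℝ f) y (stdBasis n i))]
    simp only [map_sum, map_smul, smul_eq_mul]
  simp only [h]
  exact sum_symm_mul_antisymm (fun i j => fderiv_fderiv_symm hf _ _) fun i j => ht _ _

theorem hasFDerivAt_fderiv {f : Cn n → ℝ} {y : Cn n} (hf : ContDiffAt ℝ 2 f y) :
    HasFDerivAt (fderiv ℝ f) (fderiv ℝ (fderiv ℝ f) y) y :=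
  ((hf.fderiv_right (m := 1) (by norm_num)).differentiableAt (by norm_num)).hasFDerivAt

/-- Coordinate form of `d(u df ∧ W^(n-1)) = du ∧ df ∧ W^(n-1)`, up to sign and a constant. The
product rule gives three kinds of terms: those differentiating `W` cancel since `W` is closed, those
differentiating `df` cancel by symmetry of the Hessian, and those differentiating `u` remain. -/
theorem sum_deriv_dVol {W : Cn n → Two n} {f u : Cn n → ℝ} {y : Cn n}
    (hW : DifferentiableAt ℝ W y) (hc : extDeriv W y = 0) (hN : Nondeg (W y))
    (hf : ContDiffAt ℝ 2 f y) (hu : DifferentiableAt ℝ u y) :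
    ∑ i, fderiv ℝ (fun y => u y * dVol n (W y) (wedge (fderiv ℝ f y) (dualCov i))) y
      (stdBasis n i) = dVol n (W y) (wedge (fderiv ℝ f y) (fderiv ℝ u y)) := by
  have hd : ∀ i, fderiv ℝ (fun y => u y * dVol n (W y) (wedge (fderiv ℝ f y) (dualCov i))) y
      (stdBasis n i) = fderiv ℝ u y (stdBasis n i) *
        dVol n (W y) (wedge (fderiv ℝ f y) (dualCov i)) -
      u y * (ddVol n (W y) (fderiv ℝ W y (stdBasis n i)) (wedge (dualCov i) (fderiv ℝ f y)) +
        dVol n (W y) (wedge (dualCov i) (fderiv ℝ (fderiv ℝ f) y (stdBasis n i)))) := by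
    intro i
    have h1 : HasFDerivAt (fun y => dVol n (W y)) (ddVol n (W y) ∘L fderiv ℝ W y) y :=
      (hasFDerivAt_dVol (W y)).comp y hW.hasFDerivAt
    have h2 : HasFDerivAt (fun y => wedge (fderiv ℝ f y) (dualCov i))
        ((wedge.flip (dualCov i)) ∘L fderiv ℝ (fderiv ℝ f) y) y :=
      (wedge.flip (dualCov i)).hasFDerivAt.comp y (hasFDerivAt_fderiv hf)
    rw [(hu.hasFDerivAt.fun_mul (h1.clm_apply h2)).fderiv]
    simp
    rw [wedge_swap (dualCov i), wedge_swap (dualCov i) (fderiv ℝ (fderiv ℝ f) y (stdBasis n i))]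
    simp
    ring
  simp only [hd]
  rw [Finset.sum_sub_distrib, ← Finset.mul_sum, Finset.sum_add_distrib,
    sum_closed_contraction (ddVol_wedge_left hN) hW hc]
  have := sum_hessian_contraction hf
    (t := (ContinuousLinearMap.compL ℝ (Cov n) (Two n) ℝ (dVol n (W y))) ∘L wedge)
    (fun a b => by simp [wedge_swap a b])
  simp only [ContinuousLinearMap.comp_apply, ContinuousLinearMap.compL_apply] at this
  rw [this]
  conv_rhs => rw [← sum_dualCov (fderiv ℝ u y)]
  simp

variable (n) in
/-- The third derivative of `η ↦ η^n`. -/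
def dddVol (η : Two n) : Two n →L[ℝ] Two n →L[ℝ] Two n →L[ℝ] ℝ := fderiv ℝ (ddVol n) η

theorem hasFDerivAt_ddVol (η : Two n) : HasFDerivAt (ddVol n) (dddVol n η) η :=
  (contDiff_ddVol.differentiable (by simp) η).hasFDerivAt

theorem dddVol_swap_left (η δ ε ζ : Two n) : dddVol n η δ ε ζ = dddVol n η ε δ ζ :=
  congrArg (fun f : Two n →L[ℝ] ℝ => f ζ) <| contDiff_dVol.contDiffAt.isSymmSndFDerivAt
    (by rw [minSmoothness_of_isRCLikeNormedField]; exact WithTop.coe_le_coe.2 le_top) δ ε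

theorem hasFDerivAt_ddVol_apply (η ε ζ : Two n) :
    HasFDerivAt (fun η => ddVol n η ε ζ) (((dddVol n η).flip ε).flip ζ) η := by
  simpa using ((hasFDerivAt_ddVol η).clm_apply (hasFDerivAt_const ε η)).clm_apply
    (hasFDerivAt_const ζ η)

theorem dddVol_swap_right (η δ ε ζ : Two n) : dddVol n η δ ε ζ = dddVol n η δ ζ ε := by
  have h := hasFDerivAt_ddVol_apply η ε ζ
  simp only [ddVol_symm _ ε ζ] at h
  exact congrArg (fun f : Two n →L[ℝ] ℝ => f δ) (h.unique (hasFDerivAt_ddVol_apply η ζ ε))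

/-- The identity `ddVol_wedge_left` holds on the open set of nondegenerate forms, so it may be
differentiated in the direction `ζ`. Symmetry of the third derivative brings `ζ` into the slot of
differentiation. -/
theorem dddVol_wedge_left {η : Two n} (h : Nondeg η) (a b c : Cov n) (ζ : Two n) :
    dddVol n η (wedge a b) (wedge a c) ζ = 0 := by
  rw [dddVol_swap_right, dddVol_swap_left]
  have h1 : (fun η => ddVol n η (wedge a b) (wedge a c)) =ᶠ[𝓝 η] fun _ => 0 := by
    filter_upwards [isOpen_nondeg.mem_nhds h] with η' h' using ddVol_wedge_left h' a b c
  exact congrArg (fun f : Two n →L[ℝ] ℝ => f ζ) <|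
    (hasFDerivAt_ddVol_apply η (wedge a b) (wedge a c)).unique
      ((hasFDerivAt_const (0 : ℝ) η).congr_of_eventuallyEq h1)

/-- The exterior derivative of a one-form in terms of partial derivatives. -/
theorem extDeriv_oneForm {c : Cn n → Cov n} {y : Cn n} (hc : DifferentiableAt ℝ c y) :
    extDeriv (fun y => ContinuousAlternatingMap.ofSubsingleton ℝ (Cn n) ℝ (0 : Fin 1) (c y)) y =
      ∑ i, wedge (dualCov i) (fderiv ℝ c y (stdBasis n i)) := by
  have hd : HasFDerivAt
      (fun y => ContinuousAlternatingMap.ofSubsingleton ℝ (Cn n) ℝ (0 : Fin 1) (c y))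
      ((ContinuousAlternatingMap.ofSubsingletonLIE (𝕜 := ℝ) (E := Cn n) (F := ℝ)
        (0 : Fin 1)).toContinuousLinearEquiv.toContinuousLinearMap ∘L fderiv ℝ c y) y :=
    ((ContinuousAlternatingMap.ofSubsingletonLIE (𝕜 := ℝ) (E := Cn n) (F := ℝ)
      (0 : Fin 1)).toContinuousLinearEquiv.toContinuousLinearMap.hasFDerivAt).comp y hc.hasFDerivAt
  refine two_ext fun v w => ?_
  have h : ∀ u : Fin 2 → Cn n, extDeriv (fun y =>
      ContinuousAlternatingMap.ofSubsingleton ℝ (Cn n) ℝ (0 : Fin 1) (c y)) y u =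
      ∑ i : Fin 2, (-1) ^ i.val • fderiv ℝ (fun y => c y (i.removeNth u 0)) y (u i) :=
    fun u => extDeriv_apply hd.differentiableAt _
  have e : ∀ p x : Cn n, fderiv ℝ (fun y => c y p) y x = fderiv ℝ c y x p := fun p x => by
    simpa using congrArg (fun f : Cov n => f x)
      (hc.hasFDerivAt.clm_apply (hasFDerivAt_const p y)).fderiv
  have hv : ∀ v, fderiv ℝ c y v = ∑ i, dualCov i v • fderiv ℝ c y (stdBasis n i) := fun v => by
    conv_lhs => rw [← (stdBasis n).sum_repr v]
    simp [dualCov, -Module.Basis.sum_repr]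
  rw [h, Fin.sum_univ_two, e, e]
  simp [Fin.removeNth, wedge_apply, Fin.succAbove]
  rw [hv v, hv w]
  simp [mul_comm]
  ring

/-- Coordinate form of `d(h c ∧ df ∧ dg ∧ W^(n-2)) = (dh ∧ c + h dc) ∧ df ∧ dg ∧ W^(n-2)`, up to a
constant. The derivatives of `W`, `df` and `dg` contribute nothing, for the reasons in
`sum_deriv_dVol`; those of `c` assemble to `dc` by `extDeriv_oneForm`. -/
theorem sum_deriv_ddVol {W : Cn n → Two n} {f g h : Cn n → ℝ} {c : Cn n → Cov n} {y : Cn n}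
    (hW : DifferentiableAt ℝ W y) (hcl : extDeriv W y = 0) (hN : Nondeg (W y))
    (hf : ContDiffAt ℝ 2 f y) (hg : ContDiffAt ℝ 2 g y) (hh : DifferentiableAt ℝ h y)
    (hc : DifferentiableAt ℝ c y) :
    ∑ i, fderiv ℝ (fun y => h y * quartic (W y) (dualCov i) (c y) (fderiv ℝ f y) (fderiv ℝ g y)) y
      (stdBasis n i) = quartic (W y) (fderiv ℝ h y) (c y) (fderiv ℝ f y) (fderiv ℝ g y) +
      h y * ddVol n (W y) (extDeriv (fun y =>
        ContinuousAlternatingMap.ofSubsingleton ℝ (Cn n) ℝ (0 : Fin 1) (c y)) y)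
        (wedge (fderiv ℝ f y) (fderiv ℝ g y)) := by
  set ζ := wedge (fderiv ℝ f y) (fderiv ℝ g y) with hζ
  have hd : ∀ i, fderiv ℝ (fun y => h y *
      quartic (W y) (dualCov i) (c y) (fderiv ℝ f y) (fderiv ℝ g y)) y (stdBasis n i) =
      fderiv ℝ h y (stdBasis n i) * ddVol n (W y) (wedge (dualCov i) (c y)) ζ +
      h y * ((dddVol n (W y) (fderiv ℝ W y (stdBasis n i)) (wedge (dualCov i) (c y)) ζ +
        ddVol n (W y) (wedge (dualCov i) (fderiv ℝ c y (stdBasis n i))) ζ) +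
        (quartic (W y) (dualCov i) (c y) (fderiv ℝ (fderiv ℝ f) y (stdBasis n i)) (fderiv ℝ g y) +
        quartic (W y) (dualCov i) (c y) (fderiv ℝ f y)
          (fderiv ℝ (fderiv ℝ g) y (stdBasis n i)))) := by
    intro i
    have h1 : HasFDerivAt (fun y => ddVol n (W y)) (dddVol n (W y) ∘L fderiv ℝ W y) y :=
      (hasFDerivAt_ddVol (W y)).comp y hW.hasFDerivAt
    have h2 : HasFDerivAt (fun y => wedge (dualCov i) (c y))
        (wedge (dualCov i) ∘L fderiv ℝ c y) y :=
      (wedge (dualCov i)).hasFDerivAt.comp y hc.hasFDerivAt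
    have h3 : HasFDerivAt (fun y => wedge (fderiv ℝ f y)) (wedge ∘L fderiv ℝ (fderiv ℝ f) y) y :=
      (wedge (n := n)).hasFDerivAt.comp y (hasFDerivAt_fderiv hf)
    have h4 := h3.clm_apply (hasFDerivAt_fderiv hg)
    simp only [quartic]
    rw [(hh.hasFDerivAt.fun_mul ((h1.clm_apply h2).clm_apply h4)).fderiv]
    simp [← hζ]
    ring
  simp only [hd]
  rw [Finset.sum_add_distrib, ← Finset.mul_sum, Finset.sum_add_distrib, Finset.sum_add_distrib,
    Finset.sum_add_distrib]
  have e1 : ∑ i, dddVol n (W y) (fderiv ℝ W y (stdBasis n i)) (wedge (dualCov i) (c y)) ζ = 0 :=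
    sum_closed_contraction (q := (ContinuousLinearMap.compL ℝ (Two n) (Two n →L[ℝ] ℝ) ℝ
      (ContinuousLinearMap.apply ℝ ℝ ζ)) ∘L dddVol n (W y))
      (fun a b c => dddVol_wedge_left hN a b c ζ) hW hcl (c y)
  have e2 : ∑ i, quartic (W y) (dualCov i) (c y) (fderiv ℝ (fderiv ℝ f) y (stdBasis n i))
      (fderiv ℝ g y) = 0 :=
    sum_hessian_contraction hf (t := (ContinuousLinearMap.compL ℝ (Cov n) (Two n) ℝ).flip
      (wedge.flip (fderiv ℝ g y)) ∘L ddVol n (W y) ∘L wedge.flip (c y))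
      (fun a b => quartic_exchange hN a (c y) b _)
  have e3 : ∑ i, quartic (W y) (dualCov i) (c y) (fderiv ℝ f y)
      (fderiv ℝ (fderiv ℝ g) y (stdBasis n i)) = 0 :=
    sum_hessian_contraction hg (t := (ContinuousLinearMap.compL ℝ (Cov n) (Two n) ℝ).flip
      (wedge (fderiv ℝ f y)) ∘L ddVol n (W y) ∘L wedge.flip (c y))
      (fun a b => by
        change quartic (W y) a (c y) (fderiv ℝ f y) b = - quartic (W y) b (c y) (fderiv ℝ f y) a
        rw [quartic_swap_right, quartic_exchange hN, quartic_swap_right _ b, neg_neg])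
  rw [e1, e2, e3, zero_add, add_zero, add_zero, extDeriv_oneForm hc]
  congr 1
  · conv_rhs => rw [← sum_dualCov (fderiv ℝ h y)]
    simp [quartic, hζ]
  · simp

end Divergence

/-! ### The operators `d^c` and `i∂∂̄` under holomorphic maps -/

section Holomorphic

variable {n : ℕ}

/-- The covector `½ d^c f`. -/
def halfDc (f : Cn n → ℝ) (y : Cn n) : Cov n := (-2⁻¹ : ℝ) • (fderiv ℝ f y ∘L mulI n)

theorem contDiffAt_dc {f : Cn n → ℝ} {y : Cn n} {k m : ℕ∞ω} (hf : ContDiffAt ℝ m f y)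
    (h : k + 1 ≤ m) : ContDiffAt ℝ k (dc f) y := by
  have h1 : ContDiffAt ℝ k (fderiv ℝ f) y := hf.fderiv_right h
  have h2 := (ContinuousLinearMap.contDiff
    ((ContinuousLinearMap.compL ℝ (Cn n) (Cn n) ℝ).flip (mulI n))).contDiffAt.comp (n := k) y h1
  exact (ContinuousAlternatingMap.ofSubsingletonLIE (𝕜 := ℝ) (E := Cn n) (F := ℝ)
    (0 : Fin 1)).toContinuousLinearEquiv.toContinuousLinearMap.contDiff.contDiffAt.comp y h2.neg

theorem iddbarCn_eq_extDeriv (f : Cn n → ℝ) (y : Cn n) : iddbarCn f y =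
    extDeriv (fun y => ContinuousAlternatingMap.ofSubsingleton ℝ (Cn n) ℝ (0 : Fin 1)
      (halfDc f y)) y := by
  have h : (2 : ℝ)⁻¹ • dc f = fun y => ContinuousAlternatingMap.ofSubsingleton ℝ (Cn n) ℝ
      (0 : Fin 1) (halfDc f y) := by
    funext z
    refine ContinuousAlternatingMap.ext fun v => ?_
    simp [dc, halfDc]
  rw [← h, extDeriv_smul, iddbarCn]

theorem iddbarCn_congr {f g : Cn n → ℝ} {y : Cn n} (h : f =ᶠ[𝓝 y] g) :
    iddbarCn f y = iddbarCn g y := by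
  have : dc f =ᶠ[𝓝 y] dc g := by
    filter_upwards [h.fderiv (𝕜 := ℝ)] with z hz
    simp only [dc, hz]
  rw [iddbarCn, this.extDeriv_eq, iddbarCn]

theorem fderiv_comp_mulI {τ : Cn n → Cn n} {y : Cn n} (hτ : DifferentiableAt ℂ τ y) :
    fderiv ℝ τ y ∘L mulI n = mulI n ∘L fderiv ℝ τ y := by
  rw [hτ.fderiv_restrictScalars ℝ]
  ext v
  simp [mulI]

/-- Holomorphic maps do not reverse orientation; this removes the absolute value from the Jacobian
when charts are changed in an integral. -/
theorem det_fderiv_nonneg {τ : Cn n → Cn n} {y : Cn n} (hτ : DifferentiableAt ℂ τ y) :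
    0 ≤ (fderiv ℝ τ y).det := by
  rw [hτ.fderiv_restrictScalars ℝ, det_restrictScalars]
  exact Complex.normSq_nonneg _

theorem halfDc_comp {f : Cn n → ℝ} {τ : Cn n → Cn n} {y : Cn n} (hτ : DifferentiableAt ℂ τ y)
    (hf : DifferentiableAt ℝ f (τ y)) :
    halfDc (f ∘ τ) y = halfDc f (τ y) ∘L fderiv ℝ τ y := by
  rw [halfDc, fderiv_comp y hf (hτ.restrictScalars ℝ), halfDc, ContinuousLinearMap.smul_comp,
    ContinuousLinearMap.comp_assoc, fderiv_comp_mulI hτ, ContinuousLinearMap.comp_assoc]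

/-- A holomorphic differential commutes with multiplication by `i`, so `d^c` commutes with the
pullback, and `d` always does. Hence `iddbar`, which uses a different chart at each point, is chart
independent. -/
theorem iddbarCn_comp {f : Cn n → ℝ} {τ : Cn n → Cn n} {y : Cn n} (hτ : ContDiffAt ℂ ω τ y)
    (hf : ContDiffAt ℝ ∞ f (τ y)) :
    iddbarCn (f ∘ τ) y = pull (fderiv ℝ τ y) (iddbarCn f (τ y)) := by
  have hτ' : ContDiffAt ℝ ω τ y := hτ.restrict_scalars ℝ
  have h1 : dc (f ∘ τ) =ᶠ[𝓝 y] fun z => (dc f (τ z)).compContinuousLinearMap (fderiv ℝ τ z) := by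
    have hev : ∀ᶠ z in 𝓝 y, DifferentiableAt ℂ τ z := by
      filter_upwards [(hτ.of_le le_top : ContDiffAt ℂ 1 τ y).eventually (by simp)] with z hz
      exact hz.differentiableAt (by simp)
    have hev2 : ∀ᶠ z in 𝓝 y, DifferentiableAt ℝ f (τ z) := by
      have := (hf.of_le (by exact_mod_cast le_top) : ContDiffAt ℝ 1 f (τ y)).eventually (by simp)
      filter_upwards [hτ.continuousAt.eventually this] with z hz
      exact hz.differentiableAt (by simp)
    filter_upwards [hev, hev2] with z hz hz'
    ext v
    have := congrArg (fun c : Cov n => c (v 0)) (halfDc_comp hz hz')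
    simp [halfDc] at this
    simpa [dc] using this
  rw [iddbarCn, h1.extDeriv_eq, extDeriv_pullback (r := ω)
    ((contDiffAt_dc hf (k := 1) (WithTop.coe_le_coe.2 le_top)).differentiableAt (by simp)) hτ' (by simp)]
  rfl

theorem extDeriv_iddbarCn {f : Cn n → ℝ} {y : Cn n} (hf : ContDiffAt ℝ ∞ f y) :
    extDeriv (iddbarCn f) y = 0 := by
  have : iddbarCn f = (2 : ℝ)⁻¹ • extDeriv (dc f) := rfl
  rw [this, extDeriv_smul, extDeriv_extDeriv_apply (r := ∞) (contDiffAt_dc hf (by simp)), smul_zero]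
  rw [minSmoothness_of_isRCLikeNormedField]; exact WithTop.coe_le_coe.2 le_top

end Holomorphic

/-! ### Coordinate changes, and functions and two-forms in holomorphic charts -/

section Charts

variable {n : ℕ} {X : Type*} [TopologicalSpace X]

theorem eventually_transition {Y : Type*} (f : X → Y) {e e' : OpenPartialHomeomorph X (Cn n)}
    {x : X} (hx : x ∈ e.source) (hx' : x ∈ e'.source) :
    (f ∘ e.symm) =ᶠ[𝓝 (e x)] (f ∘ e'.symm) ∘ (e' ∘ e.symm) := by
  have : (e.symm ≫ₕ e').source ∈ 𝓝 (e x) := (e.symm ≫ₕ e').open_source.mem_nhds <| by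
    simp [e.map_source hx, e.left_inv hx, hx']
  filter_upwards [this] with y hy
  have hy' : e.symm y ∈ e'.source := by simp at hy; exact hy.2
  simp [e'.left_inv hy']

/-- The differential of the coordinate change from `e` to `e'` at `x`. -/
def jac (e e' : OpenPartialHomeomorph X (Cn n)) (x : X) : Cn n →L[ℝ] Cn n :=
  fderiv ℝ (e' ∘ e.symm) (e x)

theorem jac_self {e : OpenPartialHomeomorph X (Cn n)} {x : X} (hx : x ∈ e.source) :
    jac e e x = ContinuousLinearMap.id ℝ (Cn n) := by
  have h : (e ∘ e.symm) =ᶠ[𝓝 (e x)] id := by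
    filter_upwards [e.open_target.mem_nhds (e.map_source hx)] with y hy
    exact e.right_inv hy
  rw [jac, h.fderiv_eq, fderiv_id]

variable [ChartedSpace (Cn n) X]

theorem contDiffAt_transition [IsManifold 𝓘(ℂ, Cn n) ω X] {e e' : OpenPartialHomeomorph X (Cn n)}
    (he : e ∈ atlas (Cn n) X) (he' : e' ∈ atlas (Cn n) X) {x : X} (hx : x ∈ e.source)
    (hx' : x ∈ e'.source) : ContDiffAt ℂ ω (e' ∘ e.symm) (e x) := by
  have h : e.symm ≫ₕ e' ∈ contDiffGroupoid ω 𝓘(ℂ, Cn n) :=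
    HasGroupoid.compatible he he'
  rw [contDiffGroupoid, mem_groupoid_of_pregroupoid] at h
  have h3 : ContDiffOn ℂ ω (e' ∘ e.symm) ((e.symm ≫ₕ e').source ∩ Set.range 𝓘(ℂ, Cn n)) := h.1
  refine h3.contDiffAt (Filter.inter_mem ((e.symm ≫ₕ e').open_source.mem_nhds ?_) (by simp))
  simp [e.map_source hx, e.left_inv hx, hx']

theorem differentiableAt_transition [IsManifold 𝓘(ℂ, Cn n) ω X] {e e' : OpenPartialHomeomorph X (Cn n)}
    (he : e ∈ atlas (Cn n) X) (he' : e' ∈ atlas (Cn n) X) {x : X} (hx : x ∈ e.source)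
    (hx' : x ∈ e'.source) : DifferentiableAt ℂ (e' ∘ e.symm) (e x) :=
  (contDiffAt_transition he he' hx hx').differentiableAt (by simp)

/-- The value at `x` of a two-form on `X`, as a form on `ℂⁿ`. -/
def TwoForm.val (ζ : TwoForm n X) (x : X) : Two n := ζ x

theorem nondeg_of_mem_potentials {η : TwoForm n X} {φ : SmoothFn n X} (hφ : φ ∈ potentials η)
    (x : X) : Nondeg (TwoForm.val (perturbed η φ) x) := by
  intro v hv
  by_contra h
  exact (hφ x v h).ne' (hv _)

variable [IsManifold 𝓘(ℂ, Cn n) ω X]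

theorem jac_comp {e e' e'' : OpenPartialHomeomorph X (Cn n)} (he : e ∈ atlas (Cn n) X)
    (he' : e' ∈ atlas (Cn n) X) (he'' : e'' ∈ atlas (Cn n) X) {x : X} (hx : x ∈ e.source)
    (hx' : x ∈ e'.source) (hx'' : x ∈ e''.source) :
    jac e e'' x = jac e' e'' x ∘L jac e e' x := by
  have h := (eventually_transition e'' hx hx').fderiv_eq (𝕜 := ℝ)
  have hp : (e' ∘ e.symm) (e x) = e' x := by simp [e.left_inv hx]
  have h1 := (differentiableAt_transition he' he'' hx' hx'').restrictScalars ℝ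
  rw [jac, h, fderiv_comp _ (by rw [hp]; exact h1)
    ((differentiableAt_transition he he' hx hx').restrictScalars ℝ), hp]
  rfl

theorem injective_jac {e e' : OpenPartialHomeomorph X (Cn n)} (he : e ∈ atlas (Cn n) X)
    (he' : e' ∈ atlas (Cn n) X) {x : X} (hx : x ∈ e.source) (hx' : x ∈ e'.source) :
    Function.Injective (jac e e' x) := by
  have h := jac_comp he he' he hx hx' hx
  rw [jac_self hx] at h
  exact Function.LeftInverse.injective (g := jac e' e x) fun v =>
    (congrArg (fun L : Cn n →L[ℝ] Cn n => L v) h).symm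

theorem det_jac_nonneg {e e' : OpenPartialHomeomorph X (Cn n)} (he : e ∈ atlas (Cn n) X)
    (he' : e' ∈ atlas (Cn n) X) {x : X} (hx : x ∈ e.source) (hx' : x ∈ e'.source) :
    0 ≤ (jac e e' x).det :=
  det_fderiv_nonneg (differentiableAt_transition he he' hx hx')

/-! ### Smooth functions in charts -/

theorem contMDiffOn_chart_symm {e : OpenPartialHomeomorph X (Cn n)} (he : e ∈ atlas (Cn n) X) :
    ContMDiffOn 𝓘(ℝ, Cn n) 𝓘(ℝ, Cn n) ∞ e.symm e.target :=
  haveI := isManifold_real n X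
  contMDiffOn_symm_of_mem_maximalAtlas (IsManifold.subset_maximalAtlas he)

theorem contDiffOn_chart {e : OpenPartialHomeomorph X (Cn n)} (he : e ∈ atlas (Cn n) X)
    (f : SmoothFn n X) : ContDiffOn ℝ ∞ (f ∘ e.symm) e.target :=
  (f.contMDiff.comp_contMDiffOn (contMDiffOn_chart_symm he)).contDiffOn

theorem contDiffAt_chart {e : OpenPartialHomeomorph X (Cn n)} (he : e ∈ atlas (Cn n) X)
    (f : SmoothFn n X) {y : Cn n} (hy : y ∈ e.target) : ContDiffAt ℝ ∞ (f ∘ e.symm) y :=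
  (contDiffOn_chart he f).contDiffAt (e.open_target.mem_nhds hy)

theorem contDiffOn_curve_chart {e : OpenPartialHomeomorph X (Cn n)} (he : e ∈ atlas (Cn n) X)
    {c : ℝ → SmoothFn n X} (hc : IsSmoothCurve c) :
    ContDiffOn ℝ ∞ (fun p : ℝ × Cn n => c p.1 (e.symm p.2)) (Set.univ ×ˢ e.target) := by
  have h1 : ContMDiffOn (𝓘(ℝ, ℝ).prod 𝓘(ℝ, Cn n)) (𝓘(ℝ, ℝ).prod 𝓘(ℝ, Cn n)) ∞
      (fun p : ℝ × Cn n => (p.1, e.symm p.2)) (Set.univ ×ˢ e.target) :=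
    (contMDiffOn_id (s := (Set.univ : Set ℝ))).prodMap (contMDiffOn_chart_symm he)
  have h2 := ContMDiff.comp_contMDiffOn hc h1
  rw [← modelWithCornersSelf_prod, chartedSpaceSelf_prod] at h2
  exact h2.contDiffOn

theorem fderiv_chart_eq {e e' : OpenPartialHomeomorph X (Cn n)} (he : e ∈ atlas (Cn n) X)
    (he' : e' ∈ atlas (Cn n) X) {x : X} (hx : x ∈ e.source) (hx' : x ∈ e'.source)
    (f : SmoothFn n X) :
    fderiv ℝ (f ∘ e.symm) (e x) = fderiv ℝ (f ∘ e'.symm) (e' x) ∘L jac e e' x := by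
  have hp : (e' ∘ e.symm) (e x) = e' x := by simp [e.left_inv hx]
  have h1 := (contDiffAt_chart he' f (e'.map_source hx')).differentiableAt (by simp)
  rw [(eventually_transition f hx hx').fderiv_eq, fderiv_comp _ (by rw [hp]; exact h1)
    ((differentiableAt_transition he he' hx hx').restrictScalars ℝ), hp]
  rfl

theorem halfDc_chart_eq {e e' : OpenPartialHomeomorph X (Cn n)} (he : e ∈ atlas (Cn n) X)
    (he' : e' ∈ atlas (Cn n) X) {x : X} (hx : x ∈ e.source) (hx' : x ∈ e'.source)
    (f : SmoothFn n X) :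
    halfDc (f ∘ e.symm) (e x) = halfDc (f ∘ e'.symm) (e' x) ∘L jac e e' x := by
  rw [halfDc, fderiv_chart_eq he he' hx hx', halfDc, ContinuousLinearMap.comp_assoc, jac,
    fderiv_comp_mulI (differentiableAt_transition he he' hx hx'), ContinuousLinearMap.smul_comp,
    ContinuousLinearMap.comp_assoc]

theorem iddbarCn_chart_eq {e e' : OpenPartialHomeomorph X (Cn n)} (he : e ∈ atlas (Cn n) X)
    (he' : e' ∈ atlas (Cn n) X) {x : X} (hx : x ∈ e.source) (hx' : x ∈ e'.source)
    (f : SmoothFn n X) :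
    iddbarCn (f ∘ e.symm) (e x) = pull (jac e e' x) (iddbarCn (f ∘ e'.symm) (e' x)) := by
  have hp : (e' ∘ e.symm) (e x) = e' x := by simp [e.left_inv hx]
  have h1 := contDiffAt_chart he' f (e'.map_source hx')
  rw [iddbarCn_congr (eventually_transition f hx hx'),
    iddbarCn_comp (contDiffAt_transition he he' hx hx') (by rw [hp]; exact h1), hp]
  rfl

/-! ### Tangent vectors and two-forms in charts -/

theorem mdifferentiableAt_chart_symm {e : OpenPartialHomeomorph X (Cn n)}
    (he : e ∈ atlas (Cn n) X) {y : Cn n} (hy : y ∈ e.target) :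
    MDifferentiableAt 𝓘(ℝ, Cn n) 𝓘(ℝ, Cn n) e.symm y :=
  ((contMDiffOn_chart_symm he).contMDiffAt (e.open_target.mem_nhds hy)).mdifferentiableAt (by simp)

theorem chartFrame_eq {e : OpenPartialHomeomorph X (Cn n)} (he : e ∈ atlas (Cn n) X) {y : Cn n}
    (hy : y ∈ e.target) : (chartFrame e y : Cn n →L[ℝ] Cn n) =
      jac e (chartAt (Cn n) (e.symm y)) (e.symm y) := by
  rw [chartFrame, (mdifferentiableAt_chart_symm he hy).mfderiv, jac, e.right_inv hy]
  simp [writtenInExtChartAt, extChartAt, fderivWithin_univ]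
  rfl

theorem inChart_eq {e : OpenPartialHomeomorph X (Cn n)} (he : e ∈ atlas (Cn n) X) {x : X}
    (hx : x ∈ e.source) (ζ : TwoForm n X) :
    ζ.inChart e (e x) = pull (jac e (chartAt (Cn n) x) x) (ζ.val x) := by
  obtain ⟨y, hy, rfl⟩ : ∃ y ∈ e.target, x = e.symm y :=
    ⟨e x, e.map_source hx, (e.left_inv hx).symm⟩
  rw [e.right_inv hy, ← chartFrame_eq he hy]
  rfl

theorem inChart_transition {e e' : OpenPartialHomeomorph X (Cn n)} (he : e ∈ atlas (Cn n) X)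
    (he' : e' ∈ atlas (Cn n) X) {x : X} (hx : x ∈ e.source) (hx' : x ∈ e'.source)
    (ζ : TwoForm n X) : ζ.inChart e (e x) = pull (jac e e' x) (ζ.inChart e' (e' x)) := by
  rw [inChart_eq he hx, inChart_eq he' hx', jac_comp he he' (chart_mem_atlas (Cn n) x) hx hx'
    (mem_chart_source _ x)]
  rfl

/-- The form `ω_φ` in a chart. -/
def localForm (η : TwoForm n X) (φ : SmoothFn n X) (e : OpenPartialHomeomorph X (Cn n))
    (y : Cn n) : Two n := η.inChart e y + iddbarCn (φ ∘ e.symm) y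

/-- `perturbed` is computed at each point in that point's preferred chart, whereas `localForm` uses
one chart throughout; only the latter can be differentiated. -/
theorem localForm_eq (η : TwoForm n X) (φ : SmoothFn n X) {e : OpenPartialHomeomorph X (Cn n)}
    (he : e ∈ atlas (Cn n) X) {x : X} (hx : x ∈ e.source) :
    localForm η φ e (e x) = pull (jac e (chartAt (Cn n) x) x) (TwoForm.val (perturbed η φ) x) := by
  rw [localForm, inChart_eq he hx,
    iddbarCn_chart_eq he (chart_mem_atlas (Cn n) x) hx (mem_chart_source _ x)]
  exact (map_add (pull (jac e (chartAt (Cn n) x) x)) _ _).symm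

theorem localForm_transition (η : TwoForm n X) (φ : SmoothFn n X)
    {e e' : OpenPartialHomeomorph X (Cn n)} (he : e ∈ atlas (Cn n) X)
    (he' : e' ∈ atlas (Cn n) X) {x : X} (hx : x ∈ e.source) (hx' : x ∈ e'.source) :
    localForm η φ e (e x) = pull (jac e e' x) (localForm η φ e' (e' x)) := by
  rw [localForm, inChart_transition he he' hx hx', iddbarCn_chart_eq he he' hx hx', localForm,
    map_add]

theorem nondeg_of_pull {L : Cn n →L[ℝ] Cn n} {ζ : Two n} (h : Nondeg (pull L ζ)) : Nondeg ζ := by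
  have hinj : Function.Injective (L : Cn n →ₗ[ℝ] Cn n) := by
    rw [← LinearMap.ker_eq_bot, LinearMap.ker_eq_bot']
    intro v hv
    refine h v fun w => ?_
    have : L v = 0 := hv
    rw [pull_apply_pair, this]
    have := two_smul_left ζ 0 0 (L w)
    rwa [zero_smul, zero_mul] at this
  intro v hv
  obtain ⟨u, rfl⟩ := LinearMap.injective_iff_surjective.1 hinj v
  have : u = 0 := h u fun w => by
    rw [pull_apply_pair]; exact hv _
  rw [this, map_zero]

theorem Nondeg.pull {L : Cn n →L[ℝ] Cn n} {ζ : Two n} (h : Nondeg ζ)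
    (hL : Function.Injective L) : Nondeg (pull L ζ) := by
  intro v hv
  have : L v = 0 := h _ fun w => by
    obtain ⟨u, rfl⟩ := LinearMap.injective_iff_surjective.1
      (show Function.Injective (L : Cn n →ₗ[ℝ] Cn n) from hL) w
    rw [← hv u, pull_apply_pair]; rfl
  exact hL (by rw [this, map_zero])

theorem nondeg_localForm_iff (η : TwoForm n X) (φ : SmoothFn n X)
    {e : OpenPartialHomeomorph X (Cn n)} (he : e ∈ atlas (Cn n) X) {x : X} (hx : x ∈ e.source) :
    Nondeg (localForm η φ e (e x)) ↔ Nondeg (TwoForm.val (perturbed η φ) x) := by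
  rw [localForm_eq η φ he hx]
  exact ⟨nondeg_of_pull, fun h => h.pull
    (injective_jac he (chart_mem_atlas (Cn n) x) hx (mem_chart_source _ x))⟩

end Charts

/-! ### Integrals of compactly supported functions -/

section Analysis

theorem integrableOn_of_compact_support {E : Type*} [NormedAddCommGroup E] [MeasurableSpace E]
    [BorelSpace E] {μ : Measure E} [IsFiniteMeasureOnCompacts μ] {U K : Set E}
    (hU : IsOpen U) (hK : IsCompact K)
    (hKU : K ⊆ U) {F : E → ℝ} (hF : ContinuousOn F U) (h0 : ∀ x ∈ U, x ∉ K → F x = 0) :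
    IntegrableOn F U μ :=
  ((hF.mono hKU).integrableOn_compact hK).of_forall_sdiff_eq_zero hU.measurableSet
    fun x hx => h0 x hx.1 hx.2

variable {E : Type*} [NormedAddCommGroup E] [NormedSpace ℝ E]

theorem contDiff_indicator {U K : Set E} (hU : IsOpen U) (hK : IsClosed K) (hKU : K ⊆ U)
    {m : ℕ∞ω} {F : E → ℝ} (hF : ContDiffOn ℝ m F U) (h0 : ∀ x ∈ U, x ∉ K → F x = 0) :
    ContDiff ℝ m (U.indicator F) := by
  rw [contDiff_iff_contDiffAt]
  intro x
  by_cases hx : x ∈ U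
  · refine (hF.contDiffAt (hU.mem_nhds hx)).congr_of_eventuallyEq ?_
    filter_upwards [hU.mem_nhds hx] with y hy using Set.indicator_of_mem hy F
  · refine contDiffAt_const (c := (0 : ℝ)) |>.congr_of_eventuallyEq ?_
    filter_upwards [hK.isOpen_compl.mem_nhds fun h => hx (hKU h)] with y hy
    by_cases hyU : y ∈ U
    · rw [Set.indicator_of_mem hyU, h0 y hyU hy]
    · rw [Set.indicator_of_notMem hyU]

section

variable [MeasurableSpace E] [BorelSpace E] {μ : Measure E} [μ.IsAddHaarMeasure]

theorem hasDerivAt_integral {s : Set ℝ} (hs : IsOpen s) {K : Set E} (hK : IsCompact K)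
    {F : ℝ → E → ℝ} (hF : ContDiffOn ℝ ∞ (fun p : ℝ × E => F p.1 p.2) (s ×ˢ Set.univ))
    (h0 : ∀ t ∈ s, ∀ x ∉ K, F t x = 0) {t : ℝ} (ht : t ∈ s) :
    HasDerivAt (fun t => ∫ x, F t x ∂μ) (∫ x, deriv (fun t => F t x) t ∂μ) t := by
  set G : ℝ × E → ℝ := fun p => F p.1 p.2
  have hd : ∀ t ∈ s, ∀ x, HasDerivAt (fun t => F t x) (fderiv ℝ G (t, x) (1, 0)) t :=
    fun t ht x => by
      have h1 : HasFDerivAt G (fderiv ℝ G (t, x)) (t, x) :=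
        ((hF.contDiffAt ((hs.prod isOpen_univ).mem_nhds ⟨ht, trivial⟩)).differentiableAt
          (by simp)).hasFDerivAt
      exact h1.comp_hasDerivAt t ((hasDerivAt_id t).prodMk (hasDerivAt_const t x))
  have hcont : ContinuousOn (fun p => fderiv ℝ G p (1, 0)) (s ×ˢ Set.univ) :=
    (hF.continuousOn_fderiv_of_isOpen (hs.prod isOpen_univ) (by simp)).clm_apply continuousOn_const
  have hz : ∀ t ∈ s, ∀ x ∉ K, fderiv ℝ G (t, x) (1, 0) = 0 := fun t ht x hx => by
    refine (hd t ht x).unique ((hasDerivAt_const t (0 : ℝ)).congr_of_eventuallyEq ?_)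
    filter_upwards [hs.mem_nhds ht] with t' ht' using h0 t' ht' x hx
  obtain ⟨ε, hε, hball⟩ := Metric.nhds_basis_closedBall.mem_iff.1 (hs.mem_nhds ht)
  -- The dominating function is this constant on `K` and zero elsewhere.
  obtain ⟨C, hC⟩ := ((isCompact_closedBall t ε).prod hK).exists_bound_of_continuousOn
    (hcont.mono (Set.prod_mono hball (Set.subset_univ K)))
  have hFc : ∀ t ∈ s, Continuous (F t) := fun t ht =>
    hF.continuousOn.comp_continuous (Continuous.prodMk_right t) fun x => ⟨ht, trivial⟩
  have key := hasDerivAt_integral_of_dominated_loc_of_deriv_le (μ := μ) (F := F)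
    (F' := fun t x => fderiv ℝ G (t, x) (1, 0)) (x₀ := t) (s := Metric.closedBall t ε)
    (bound := K.indicator fun _ => C)
    (Metric.closedBall_mem_nhds t hε)
    (by filter_upwards [hs.mem_nhds ht] with t' ht' using (hFc t' ht').aestronglyMeasurable)
    ((hFc t ht).integrable_of_hasCompactSupport (HasCompactSupport.intro hK (h0 t ht)))
    (hcont.comp_continuous (Continuous.prodMk_right t)
      fun x => ⟨ht, trivial⟩).aestronglyMeasurable
    (Filter.Eventually.of_forall fun x t' ht' => by
      by_cases hx : x ∈ K
      · rw [Set.indicator_of_mem hx]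
        exact hC (t', x) ⟨ht', hx⟩
      · rw [Set.indicator_of_notMem hx, hz t' (hball ht') x hx, norm_zero])
    ((integrable_indicator_iff hK.measurableSet).2 (integrableOn_const hK.measure_lt_top.ne))
    (Filter.Eventually.of_forall fun x t' ht' => hd t' (hball ht') x)
  have h5 : (fun x => deriv (fun t => F t x) t) = fun x => fderiv ℝ G (t, x) (1, 0) :=
    funext fun x => (hd t ht x).deriv
  rw [h5]
  exact key.2

end

variable [FiniteDimensional ℝ E] [MeasurableSpace E] [BorelSpace E] {μ : Measure E}

theorem integral_fderiv_eq_zero [μ.IsAddHaarMeasure] {F : E → ℝ} (hF : ContDiff ℝ 1 F)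
    (hc : HasCompactSupport F) (v : E) : ∫ x, fderiv ℝ F x v ∂μ = 0 := by
  have hd : Continuous fun x => fderiv ℝ F x v :=
    (hF.continuous_fderiv (by simp)).clm_apply continuous_const
  have hi : Integrable (fun x => fderiv ℝ F x v) μ :=
    hd.integrable_of_hasCompactSupport (hc.fderiv_apply ℝ v)
  -- Integration by parts against the constant function `1`.
  have := integral_mul_fderiv_eq_neg_fderiv_mul_of_integrable (μ := μ) (f := fun _ : E => (1 : ℝ))
    (g := F) (v := v) (by simp) (by simpa using hi)
    (by simpa using hF.continuous.integrable_of_hasCompactSupport hc) (by simp)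
    (fun x _ => hF.differentiable (by simp) x)
  simpa using this

theorem setIntegral_fderiv_eq_zero [μ.IsAddHaarMeasure] {U K : Set E} (hU : IsOpen U)
    (hK : IsCompact K)
    (hKU : K ⊆ U) {F : E → ℝ} (hF : ContDiffOn ℝ 1 F U) (h0 : ∀ x ∈ U, x ∉ K → F x = 0) (v : E) :
    ∫ x in U, fderiv ℝ F x v ∂μ = 0 := by
  have h1 := contDiff_indicator hU hK.isClosed hKU hF h0
  have hz : ∀ x ∉ K, U.indicator F x = 0 := fun x hx => by
    by_cases hxU : x ∈ U
    · rw [Set.indicator_of_mem hxU, h0 x hxU hx]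
    · rw [Set.indicator_of_notMem hxU]
  have h2 : HasCompactSupport (U.indicator F) := HasCompactSupport.intro hK hz
  have h3 : ∀ x ∉ U, fderiv ℝ (U.indicator F) x v = 0 := by
    intro x hx
    have : U.indicator F =ᶠ[𝓝 x] fun _ => 0 := by
      filter_upwards [hK.isClosed.isOpen_compl.mem_nhds fun h => hx (hKU h)] with y hy using hz y hy
    rw [this.fderiv_eq]
    simp
  have h4 : ∀ x ∈ U, fderiv ℝ F x v = fderiv ℝ (U.indicator F) x v := by
    intro x hx
    have : F =ᶠ[𝓝 x] U.indicator F := by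
      filter_upwards [hU.mem_nhds hx] with y hy using (Set.indicator_of_mem hy F).symm
    rw [this.fderiv_eq]
  rw [setIntegral_congr_fun hU.measurableSet h4, setIntegral_eq_integral_of_forall_compl_eq_zero h3]
  exact integral_fderiv_eq_zero h1 h2 v

variable [μ.IsAddHaarMeasure]

/-- Presents an integral as a convolution, so that smooth dependence on parameters follows from the
result for convolutions. -/
theorem convolution_one_eq_integral (g : E → ℝ) :
    (convolution (fun _ => (1 : ℝ)) g (ContinuousLinearMap.mul ℝ ℝ) μ) 0 = ∫ x, g x ∂μ := by
  rw [convolution_def]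
  simp only [ContinuousLinearMap.mul_apply', one_mul, zero_sub]
  have := Measure.IsAddHaarMeasure.isNegInvariant_of_innerRegular μ
  exact integral_neg_eq_self g μ

theorem contDiffOn_integral {s : Set ℝ} (hs : IsOpen s) {K : Set E} (hK : IsCompact K)
    {F : ℝ → E → ℝ} (hF : ContDiffOn ℝ ∞ (fun p : ℝ × E => F p.1 p.2) (s ×ˢ Set.univ))
    (h0 : ∀ t ∈ s, ∀ x ∉ K, F t x = 0) : ContDiffOn ℝ ∞ (fun t => ∫ x, F t x ∂μ) s := by
  have h := contDiffOn_convolution_right_with_param_comp (μ := μ) (n := ⊤)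
    (ContinuousLinearMap.mul ℝ ℝ) (v := fun _ : ℝ => (0 : E)) contDiffOn_const
    (f := fun _ => (1 : ℝ)) hs hK (fun t x ht hx => h0 t ht x hx)
    (locallyIntegrable_const 1) hF
  simpa only [convolution_one_eq_integral] using h

end Analysis

/-! ### Integration of densities given in charts -/

section Density

variable {n : ℕ} {X : Type*} [TopologicalSpace X] [ChartedSpace (Cn n) X]

/-- A family of functions in the preferred charts that transforms as the coefficient of a top
form. -/
def IsDensity (D : X → Cn n → ℝ) : Prop :=
  ∀ c c' x : X, x ∈ (chartAt (Cn n) c).source → x ∈ (chartAt (Cn n) c').source →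
    D c (chartAt (Cn n) c x) = (jac (chartAt (Cn n) c) (chartAt (Cn n) c') x).det *
      D c' (chartAt (Cn n) c' x)

variable [IsManifold 𝓘(ℂ, Cn n) ω X]

/-- Change of charts for the integral of a density. -/
theorem setIntegral_density {D : X → Cn n → ℝ} (hD : IsDensity D) {u : X → ℝ} {b c : X}
    (hu : ∀ x ∉ (chartAt (Cn n) c).source, u x = 0)
    (hb : ∀ x ∈ (chartAt (Cn n) c).source, x ∉ (chartAt (Cn n) b).source →
      D c (chartAt (Cn n) c x) = 0) :
    ∫ y in (chartAt (Cn n) c).target, u ((chartAt (Cn n) c).symm y) * D c y =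
      ∫ y in (chartAt (Cn n) b).target, u ((chartAt (Cn n) b).symm y) * D b y := by
  set e := chartAt (Cn n) c
  set e' := chartAt (Cn n) b
  have he : e ∈ atlas (Cn n) X := chart_mem_atlas _ _
  have he' : e' ∈ atlas (Cn n) X := chart_mem_atlas _ _
  set T := e.symm ≫ₕ e'
  have hs : ∀ y ∈ T.source, y ∈ e.target ∧ e.symm y ∈ e'.source := fun y hy => by
    simpa [T] using hy
  have ht : ∀ y ∈ T.target, y ∈ e'.target ∧ e'.symm y ∈ e.source := fun y hy => by
    simpa [T] using hy
  -- Both integrals reduce to the overlap of the charts: off it, the density vanishes on one side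
  -- and `u` on the other.
  have h1 : ∫ y in e.target, u (e.symm y) * D c y = ∫ y in T.source, u (e.symm y) * D c y := by
    refine setIntegral_eq_of_subset_of_forall_sdiff_eq_zero e.open_target.measurableSet
      (fun y hy => (hs y hy).1) fun y hy => ?_
    have hy' : e.symm y ∉ e'.source := fun h => hy.2 (by simp [T, hy.1, h])
    have := hb _ (e.map_target hy.1) hy'
    rw [e.right_inv hy.1] at this
    rw [this, mul_zero]
  have h2 : ∫ y in e'.target, u (e'.symm y) * D b y = ∫ y in T.target, u (e'.symm y) * D b y := by
    refine setIntegral_eq_of_subset_of_forall_sdiff_eq_zero e'.open_target.measurableSet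
      (fun y hy => (ht y hy).1) fun y hy => ?_
    have hy' : e'.symm y ∉ e.source := fun h => hy.2 (by simp [T, hy.1, h])
    rw [hu _ hy', zero_mul]
  rw [h1, h2, ← T.image_source_eq_target, integral_image_eq_integral_abs_det_fderiv_smul volume
    T.open_source.measurableSet (f' := fun y => jac e e' (e.symm y)) (fun y hy => ?_) T.injOn]
  · refine setIntegral_congr_fun T.open_source.measurableSet fun y hy => ?_
    obtain ⟨hy1, hy2⟩ := hs y hy
    have hy3 := e.map_target hy1
    have hd := hD c b _ hy3 hy2
    have hT : T y = e' (e.symm y) := rfl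
    rw [e.right_inv hy1] at hd
    simp only [hT, e'.left_inv hy2, abs_of_nonneg (det_jac_nonneg he he' hy3 hy2), smul_eq_mul]
    rw [hd]; ring
  · obtain ⟨hy1, hy2⟩ := hs y hy
    have := ((differentiableAt_transition he he' (e.map_target hy1) hy2).restrictScalars
      ℝ).hasFDerivAt
    rw [← jac] at this
    rw [e.right_inv hy1] at this
    exact this.hasFDerivWithinAt

variable [CompactSpace X] [T2Space X]

/-- The sum over the preferred charts of the integrals of a density against the partition of
unity. -/
def chartIntegral (D : X → Cn n → ℝ) : ℝ :=
  ∑ᶠ c : X, ∫ y in (chartAt (Cn n) c).target,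
    chartPartition n X c ((chartAt (Cn n) c).symm y) * D c y

theorem tsupport_chartPartition (c : X) :
    tsupport (chartPartition n X c) ⊆ (chartAt (Cn n) c).source :=
  (exists_chartPartition n X).choose_spec c

variable (n X) in
theorem finite_support_chartPartition : {c : X | (Function.support (chartPartition n X c)).Nonempty}.Finite :=
  (chartPartition n X).locallyFinite.finite_nonempty_of_compact

variable (n X) in
/-- The finitely many indices of nonzero functions of the partition of unity. -/
def partitionIndex : Finset X := (finite_support_chartPartition n X).toFinset

theorem chartPartition_eq_zero {c : X} (hc : c ∉ partitionIndex n X) (x : X) :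
    chartPartition n X c x = 0 := by
  by_contra h
  exact hc ((finite_support_chartPartition n X).mem_toFinset.2 ⟨x, h⟩)

theorem sum_chartPartition (x : X) : ∑ c ∈ partitionIndex n X, chartPartition n X c x = 1 := by
  rw [← (chartPartition n X).sum_eq_one (Set.mem_univ x)]
  refine (finsum_eq_sum_of_support_subset _ fun c hc => ?_).symm
  by_contra h
  exact hc (chartPartition_eq_zero h x)

theorem chartIntegral_eq_sum (D : X → Cn n → ℝ) : chartIntegral D =
    ∑ c ∈ partitionIndex n X, ∫ y in (chartAt (Cn n) c).target,
      chartPartition n X c ((chartAt (Cn n) c).symm y) * D c y := by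
  refine finsum_eq_sum_of_support_subset _ fun c hc => ?_
  by_contra h
  exact hc (by simp [chartPartition_eq_zero h])

variable (n) in
/-- The support of the partition function at `c`, in the chart at `c`. -/
def partitionSupport (c : X) : Set (Cn n) := chartAt (Cn n) c '' tsupport (chartPartition n X c)

theorem partitionSupport_subset (c : X) :
    partitionSupport n c ⊆ (chartAt (Cn n) c).target := by
  rintro _ ⟨x, hx, rfl⟩
  exact (chartAt (Cn n) c).map_source (tsupport_chartPartition c hx)

theorem isCompact_partitionSupport (c : X) : IsCompact (partitionSupport n c) :=
  (isClosed_tsupport _).isCompact.image_of_continuousOn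
    ((chartAt (Cn n) c).continuousOn.mono (tsupport_chartPartition c))

theorem chartPartition_symm_eq_zero {c : X} {y : Cn n} (hy : y ∈ (chartAt (Cn n) c).target)
    (h : y ∉ partitionSupport n c) :
    chartPartition n X c ((chartAt (Cn n) c).symm y) = 0 := by
  by_contra h'
  exact h ⟨_, subset_tsupport _ h', (chartAt (Cn n) c).right_inv hy⟩

theorem integrableOn_chart {D : X → Cn n → ℝ} {c : X}
    (hD : ContinuousOn (D c) (chartAt (Cn n) c).target) :
    IntegrableOn (fun y => chartPartition n X c ((chartAt (Cn n) c).symm y) * D c y)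
      (chartAt (Cn n) c).target := by
  refine integrableOn_of_compact_support (chartAt (Cn n) c).open_target
    (isCompact_partitionSupport c) (partitionSupport_subset c) ?_ fun y hy h => by
      rw [chartPartition_symm_eq_zero hy h, zero_mul]
  exact ((chartPartition n X c).contMDiff.continuous.comp_continuousOn
    (chartAt (Cn n) c).continuousOn_symm).mul hD

theorem chartIntegral_add {D D' : X → Cn n → ℝ}
    (hD : ∀ c, ContinuousOn (D c) (chartAt (Cn n) c).target)
    (hD' : ∀ c, ContinuousOn (D' c) (chartAt (Cn n) c).target) :
    chartIntegral (fun c y => D c y + D' c y) = chartIntegral D + chartIntegral D' := by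
  simp only [chartIntegral_eq_sum, mul_add]
  rw [← Finset.sum_add_distrib]
  exact Finset.sum_congr rfl fun c _ =>
    integral_add (integrableOn_chart (hD c)) (integrableOn_chart (hD' c))

theorem chartIntegral_const_mul (r : ℝ) (D : X → Cn n → ℝ) :
    chartIntegral (fun c y => r * D c y) = r * chartIntegral D := by
  simp only [chartIntegral_eq_sum, Finset.mul_sum]
  refine Finset.sum_congr rfl fun c _ => ?_
  rw [← integral_const_mul]
  congr 1; funext y; ring

theorem chartIntegral_sum {ι : Type*} (s : Finset ι) {D : ι → X → Cn n → ℝ}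
    (hD : ∀ i c, ContinuousOn (D i c) (chartAt (Cn n) c).target) :
    chartIntegral (fun c y => ∑ i ∈ s, D i c y) = ∑ i ∈ s, chartIntegral (D i) := by
  classical
  induction s using Finset.induction_on with
  | empty => simp [chartIntegral]
  | insert a s ha ih =>
    simp only [Finset.sum_insert ha]
    rw [chartIntegral_add (hD a) fun c => continuousOn_finsetSum _ fun i _ => hD i c, ih]

theorem chartIntegral_congr {D D' : X → Cn n → ℝ}
    (h : ∀ c, ∀ y ∈ partitionSupport n c, D c y = D' c y) : chartIntegral D = chartIntegral D' := by
  simp only [chartIntegral]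
  refine finsum_congr fun c => setIntegral_congr_fun (chartAt (Cn n) c).open_target.measurableSet
    fun y hy => ?_
  by_cases hy' : y ∈ partitionSupport n c
  · simp only [h c y hy']
  · simp only [chartPartition_symm_eq_zero hy hy', zero_mul]

/-- A density supported inside one chart can be integrated there: each term of the sum is moved to
the chart at `b`, and the partition functions then add up to one. -/
theorem chartIntegral_eq_zero_of_support {D : X → Cn n → ℝ} (hD : IsDensity D) {b : X}
    (hcont : ContinuousOn (D b) (chartAt (Cn n) b).target)
    (hsupp : ∀ c, ∀ x ∈ (chartAt (Cn n) c).source, x ∉ tsupport (chartPartition n X b) →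
      D c (chartAt (Cn n) c x) = 0)
    (hint : ∫ y in (chartAt (Cn n) b).target, D b y = 0) : chartIntegral D = 0 := by
  have h1 : ∀ c : X, ∫ y in (chartAt (Cn n) c).target,
      chartPartition n X c ((chartAt (Cn n) c).symm y) * D c y =
      ∫ y in (chartAt (Cn n) b).target,
        chartPartition n X c ((chartAt (Cn n) b).symm y) * D b y := fun c =>
    setIntegral_density hD (fun x hx => by
      by_contra h
      exact hx (tsupport_chartPartition c (subset_tsupport _ h)))
      fun x hx hx' => hsupp c x hx fun h => hx' (tsupport_chartPartition b h)
  rw [chartIntegral_eq_sum, Finset.sum_congr rfl fun c _ => h1 c, ← integral_finsetSum, ← hint]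
  · refine setIntegral_congr_fun (chartAt (Cn n) b).open_target.measurableSet fun y hy => ?_
    simp only [← Finset.sum_mul, sum_chartPartition, one_mul]
  · intro c _
    refine integrableOn_of_compact_support (chartAt (Cn n) b).open_target
      (isCompact_partitionSupport b) (partitionSupport_subset b) ?_ fun y hy h => ?_
    · exact ((chartPartition n X c).contMDiff.continuous.comp_continuousOn
        (chartAt (Cn n) b).continuousOn_symm).mul hcont
    · have := hsupp b _ ((chartAt (Cn n) b).map_target hy) fun h' =>
        h ⟨_, h', (chartAt (Cn n) b).right_inv hy⟩
      rw [(chartAt (Cn n) b).right_inv hy] at this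
      rw [this, mul_zero]

/-- Stokes' theorem for a density which is the divergence of `h • Z` in each chart. -/
theorem chartIntegral_divergence (Z : X → Fin n × Fin 2 → Cn n → ℝ)
    (hZ : ∀ c i, ContDiffOn ℝ ∞ (Z c i) (chartAt (Cn n) c).target)
    (hD : ∀ h : SmoothFn n X, IsDensity fun c y => ∑ i,
      fderiv ℝ (fun y => h ((chartAt (Cn n) c).symm y) * Z c i y) y (stdBasis n i))
    (h : SmoothFn n X) :
    chartIntegral (fun c y => ∑ i,
      fderiv ℝ (fun y => h ((chartAt (Cn n) c).symm y) * Z c i y) y (stdBasis n i)) = 0 := by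
  have hsm : ∀ (h : SmoothFn n X) (c : X) i, ContDiffOn ℝ ∞
      (fun y => h ((chartAt (Cn n) c).symm y) * Z c i y) (chartAt (Cn n) c).target := fun h c i =>
    (contDiffOn_chart (chart_mem_atlas (Cn n) c) h).mul (hZ c i)
  have hcont : ∀ (h : SmoothFn n X) (c : X), ContinuousOn (fun y => ∑ i,
      fderiv ℝ (fun y => h ((chartAt (Cn n) c).symm y) * Z c i y) y (stdBasis n i))
      (chartAt (Cn n) c).target := fun h c => continuousOn_finsetSum _ fun i _ =>
    ((hsm h c i).continuousOn_fderiv_of_isOpen (chartAt (Cn n) c).open_target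
      (by simp)).clm_apply continuousOn_const
  -- Replacing `h` by `ρ_b h` confines the support to one chart, where the divergence theorem on
  -- `ℂⁿ` applies. Summing over `b` afterwards recovers `h`.
  have hloc : ∀ b : X, chartIntegral (fun c y => ∑ i, fderiv ℝ (fun y =>
      (chartPartition n X b * h) ((chartAt (Cn n) c).symm y) * Z c i y) y (stdBasis n i)) = 0 := by
    intro b
    have hz : ∀ x ∉ tsupport (chartPartition n X b), (chartPartition n X b * h) x = 0 :=
      fun x hx => by
        change chartPartition n X b x * h x = 0
        rw [image_eq_zero_of_notMem_tsupport hx, zero_mul]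
    refine chartIntegral_eq_zero_of_support (hD _) (b := b) (hcont _ b) ?_ ?_
    · intro c x hx hxb
      refine Finset.sum_eq_zero fun i _ => ?_
      have hev : ∀ᶠ y in 𝓝 (chartAt (Cn n) c x),
          (chartAt (Cn n) c).symm y ∉ tsupport (chartPartition n X b) := by
        refine ((chartAt (Cn n) c).symm.continuousAt ((chartAt (Cn n) c).map_source hx)).eventually
          ((isClosed_tsupport _).isOpen_compl.mem_nhds ?_)
        rwa [(chartAt (Cn n) c).left_inv hx]
      have : (fun y => (chartPartition n X b * h) ((chartAt (Cn n) c).symm y) * Z c i y)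
          =ᶠ[𝓝 (chartAt (Cn n) c x)] fun _ => 0 := by
        filter_upwards [hev] with y hy
        rw [hz _ hy, zero_mul]
      rw [this.fderiv_eq]
      simp
    · have hint : ∀ i, ∫ y in (chartAt (Cn n) b).target, fderiv ℝ (fun y =>
          (chartPartition n X b * h) ((chartAt (Cn n) b).symm y) * Z b i y) y
            (stdBasis n i) = 0 := fun i =>
        setIntegral_fderiv_eq_zero (chartAt (Cn n) b).open_target (isCompact_partitionSupport b)
          (partitionSupport_subset b) ((hsm _ b i).of_le (by simp))
          (fun y hy hy' => by
            change chartPartition n X b _ * h _ * _ = 0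
            rw [chartPartition_symm_eq_zero hy hy', zero_mul, zero_mul]) _
      rw [integral_finsetSum]
      · exact Finset.sum_eq_zero fun i _ => hint i
      · intro i _
        refine integrableOn_of_compact_support (chartAt (Cn n) b).open_target
          (isCompact_partitionSupport b) (partitionSupport_subset b)
          (((hsm _ b i).continuousOn_fderiv_of_isOpen (chartAt (Cn n) b).open_target
            (by simp)).clm_apply continuousOn_const) fun y hy hy' => ?_
        have : (fun y => (chartPartition n X b * h) ((chartAt (Cn n) b).symm y) * Z b i y)
            =ᶠ[𝓝 y] fun _ => 0 := by
          filter_upwards [(chartAt (Cn n) b).open_target.mem_nhds hy,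
            (isCompact_partitionSupport b).isClosed.isOpen_compl.mem_nhds hy'] with z hz hz'
          change chartPartition n X b _ * h _ * _ = 0
          rw [chartPartition_symm_eq_zero hz hz', zero_mul, zero_mul]
        rw [this.fderiv_eq]
        simp
  rw [← Finset.sum_eq_zero fun b (_ : b ∈ partitionIndex n X) => hloc b,
    ← chartIntegral_sum _ fun b c => hcont _ c]
  refine chartIntegral_congr fun c y hy => ?_
  have hy := partitionSupport_subset c hy
  rw [Finset.sum_comm]
  refine Finset.sum_congr rfl fun i _ => ?_
  have hdiff : ∀ b ∈ partitionIndex n X, DifferentiableAt ℝ (fun y =>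
      (chartPartition n X b * h) ((chartAt (Cn n) c).symm y) * Z c i y) y := fun b _ =>
    ((hsm _ c i).contDiffAt ((chartAt (Cn n) c).open_target.mem_nhds hy)).differentiableAt (by simp)
  have : (fun y => h ((chartAt (Cn n) c).symm y) * Z c i y) = fun y => ∑ b ∈ partitionIndex n X,
      (chartPartition n X b * h) ((chartAt (Cn n) c).symm y) * Z c i y := by
    funext y
    change _ = ∑ b ∈ partitionIndex n X, chartPartition n X b _ * h _ * _
    rw [← Finset.sum_mul, ← Finset.sum_mul, sum_chartPartition, one_mul]
  rw [this, fderiv_fun_sum hdiff, _root_.sum_apply]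

end Density

/-! ### Smooth dependence on parameters -/

section Parameters

variable {n : ℕ}

theorem contDiffOn_fderiv_param {V : Type*} [NormedAddCommGroup V] [NormedSpace ℝ V]
    {F : ℝ → Cn n → V} {U : Set (Cn n)} (hU : IsOpen U)
    (hF : ContDiffOn ℝ ∞ (fun p : ℝ × Cn n => F p.1 p.2) (Set.univ ×ˢ U)) :
    ContDiffOn ℝ ∞ (fun p : ℝ × Cn n => fderiv ℝ (F p.1) p.2) (Set.univ ×ˢ U) := by
  have ho : IsOpen ((Set.univ : Set ℝ) ×ˢ U) := isOpen_univ.prod hU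
  have h1 := hF.fderiv_of_isOpen ho (m := ∞) (by simp)
  have h2 := h1.clm_comp (contDiffOn_const (c := ContinuousLinearMap.inr ℝ ℝ (Cn n)))
  refine h2.congr fun p hp => ?_
  have h3 : HasFDerivAt (fun p : ℝ × Cn n => F p.1 p.2) _ (p.1, p.2) :=
    ((hF.contDiffAt (ho.mem_nhds hp)).differentiableAt (by simp)).hasFDerivAt
  exact (h3.comp p.2 (hasFDerivAt_prodMk_right p.1 p.2)).fderiv

theorem contDiffOn_halfDc_param {F : ℝ → Cn n → ℝ} {U : Set (Cn n)} (hU : IsOpen U)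
    (hF : ContDiffOn ℝ ∞ (fun p : ℝ × Cn n => F p.1 p.2) (Set.univ ×ˢ U)) :
    ContDiffOn ℝ ∞ (fun p : ℝ × Cn n => halfDc (F p.1) p.2) (Set.univ ×ˢ U) :=
  ((contDiffOn_fderiv_param hU hF).clm_comp (contDiffOn_const (c := mulI n))).const_smul (-2⁻¹ : ℝ)

theorem iddbarCn_eq_sum {f : Cn n → ℝ} {y : Cn n} (hf : DifferentiableAt ℝ (halfDc f) y) :
    iddbarCn f y = ∑ i, wedge (dualCov i) (fderiv ℝ (halfDc f) y (stdBasis n i)) := by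
  rw [iddbarCn_eq_extDeriv, extDeriv_oneForm hf]

theorem differentiableAt_halfDc {f : Cn n → ℝ} {y : Cn n} (hf : ContDiffAt ℝ ∞ f y) :
    DifferentiableAt ℝ (halfDc f) y := by
  have h1 : ContDiffAt ℝ 1 (fderiv ℝ f) y := hf.fderiv_right (WithTop.coe_le_coe.2 le_top)
  exact ((h1.clm_comp contDiffAt_const).differentiableAt (by simp)).const_smul (-2⁻¹ : ℝ)

theorem contDiffOn_iddbarCn_param {F : ℝ → Cn n → ℝ} {U : Set (Cn n)} (hU : IsOpen U)
    (hF : ContDiffOn ℝ ∞ (fun p : ℝ × Cn n => F p.1 p.2) (Set.univ ×ˢ U)) :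
    ContDiffOn ℝ ∞ (fun p : ℝ × Cn n => iddbarCn (F p.1) p.2) (Set.univ ×ˢ U) := by
  have h1 := contDiffOn_fderiv_param (F := fun s => halfDc (F s)) hU (contDiffOn_halfDc_param hU hF)
  have h2 : ContDiffOn ℝ ∞ (fun p : ℝ × Cn n => ∑ i, wedge (dualCov i)
      (fderiv ℝ (halfDc (F p.1)) p.2 (stdBasis n i))) (Set.univ ×ˢ U) :=
    ContDiffOn.sum fun i _ =>
      (wedge (dualCov i)).contDiff.comp_contDiffOn (h1.clm_apply contDiffOn_const)
  refine h2.congr fun p hp => iddbarCn_eq_sum (differentiableAt_halfDc ?_)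
  have h3 : ContDiffAt ℝ ∞ (fun p : ℝ × Cn n => F p.1 p.2) (p.1, p.2) :=
    hF.contDiffAt ((isOpen_univ.prod hU).mem_nhds hp)
  exact h3.comp p.2 (contDiffAt_const.prodMk contDiffAt_id)

theorem iddbarCn_add_smul {f g : Cn n → ℝ} {y : Cn n} (hf : ContDiffAt ℝ ∞ f y)
    (hg : ContDiffAt ℝ ∞ g y) (t : ℝ) :
    iddbarCn (fun z => f z + t * g z) y = iddbarCn f y + t • iddbarCn g y := by
  have hdiff : ∀ {f : Cn n → ℝ}, ContDiffAt ℝ ∞ f y → ∀ᶠ z in 𝓝 y, DifferentiableAt ℝ f z :=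
    fun hf => by
      filter_upwards [(hf.of_le (WithTop.coe_le_coe.2 le_top) : ContDiffAt ℝ 1 _ y).eventually
        (by simp)] with z hz using hz.differentiableAt (by simp)
  have h : halfDc (fun z => f z + t * g z) =ᶠ[𝓝 y] fun z => halfDc f z + t • halfDc g z := by
    filter_upwards [hdiff hf, hdiff hg] with z h1 h2
    rw [halfDc, fderiv_fun_add h1 (h2.const_mul t), fderiv_const_mul h2]
    ext v
    simp [halfDc]
    ring
  have h1 := differentiableAt_halfDc hf
  have h2 := differentiableAt_halfDc hg
  have h3 : HasFDerivAt (halfDc fun z => f z + t * g z)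
      (fderiv ℝ (halfDc f) y + t • fderiv ℝ (halfDc g) y) y :=
    (h1.hasFDerivAt.add (h2.hasFDerivAt.const_smul t)).congr_of_eventuallyEq h
  rw [iddbarCn_eq_sum h3.differentiableAt, iddbarCn_eq_sum h1, iddbarCn_eq_sum h2, h3.fderiv,
    Finset.smul_sum, ← Finset.sum_add_distrib]
  refine Finset.sum_congr rfl fun i _ => ?_
  rw [_root_.add_apply, map_add, _root_.smul_apply, map_smul]

theorem mulI_mulI (v : Cn n) : mulI n (mulI n v) = -v := by
  ext i
  simp [mulI, ← mul_assoc]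

/-- `i∂∂̄f` is of type `(1, 1)`. -/
theorem iddbarCn_mulI {f : Cn n → ℝ} {y : Cn n} (hf : ContDiffAt ℝ ∞ f y) (v w : Cn n) :
    iddbarCn f y ![mulI n v, mulI n w] = iddbarCn f y ![v, w] := by
  have hf2 : ContDiffAt ℝ 2 f y := hf.of_le (WithTop.coe_le_coe.2 le_top)
  have h1 := differentiableAt_halfDc hf
  have h2 : HasFDerivAt (halfDc f) ((-2⁻¹ : ℝ) •
      ((ContinuousLinearMap.compL ℝ (Cn n) (Cn n) ℝ).flip (mulI n) ∘L
        fderiv ℝ (fderiv ℝ f) y)) y :=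
    (((ContinuousLinearMap.compL ℝ (Cn n) (Cn n) ℝ).flip (mulI n)).hasFDerivAt.comp y
      (hasFDerivAt_fderiv hf2)).const_smul (-2⁻¹ : ℝ)
  -- In terms of the Hessian, type (1,1) is immediate from its symmetry and `J² = -1`.
  have key : ∀ v w, iddbarCn f y ![v, w] =
      (-2⁻¹ : ℝ) * (fderiv ℝ (fderiv ℝ f) y v (mulI n w) -
        fderiv ℝ (fderiv ℝ f) y w (mulI n v)) := by
    intro v w
    have hv : ∀ v, fderiv ℝ (halfDc f) y v =
        ∑ i, dualCov i v • fderiv ℝ (halfDc f) y (stdBasis n i) := fun v => by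
      conv_lhs => rw [← (stdBasis n).sum_repr v]
      simp [dualCov, -Module.Basis.sum_repr]
    have e : iddbarCn f y ![v, w] = fderiv ℝ (halfDc f) y v w - fderiv ℝ (halfDc f) y w v := by
      rw [iddbarCn_eq_sum h1, hv v, hv w]
      simp [wedge_apply, mul_comm]
    rw [e, h2.fderiv]
    simp
    ring
  rw [key, key, mulI_mulI, mulI_mulI, map_neg, map_neg, fderiv_fderiv_symm hf2 (mulI n v),
    fderiv_fderiv_symm hf2 (mulI n w)]
  ring

theorem hamiltonianVector_spec {ζ : Two n} (h : Nondeg ζ) (α : Cov n) (w : Cn n) :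
    ζ ![hamiltonianVector ζ α, w] = α w :=
  Classical.epsilon_spec (h.exists_hamiltonian α) w

/-- The identity `{f, g} ω^n = n df ∧ dg ∧ ω^(n-1)` on vectors. -/
theorem hamiltonianVector_mul_volCoeff {ζ : Two n} (h : Nondeg ζ) (α β : Cov n) :
    ζ ![hamiltonianVector ζ α, hamiltonianVector ζ β] * volCoeff n ζ =
      dVol n ζ (wedge α β) := by
  rw [hamiltonianVector_spec h, dVol_wedge (hamiltonianVector_spec h β)]

/-- A statement about smooth dependence on a parameter, specialised to constant families. -/
theorem contDiffOn_of_param {V : Type*} [NormedAddCommGroup V] [NormedSpace ℝ V] {F : Cn n → V}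
    {U : Set (Cn n)} (hF : ContDiffOn ℝ ∞ (fun p : ℝ × Cn n => F p.2) (Set.univ ×ˢ U)) :
    ContDiffOn ℝ ∞ F U :=
  hF.comp (contDiffOn_const (c := (0 : ℝ)) |>.prodMk contDiffOn_id) fun _ hy => ⟨trivial, hy⟩

end Parameters

/-! ### Regularity and type of `ω_φ` in charts, and the local Poisson bracket -/

section ChartParameters

variable {n : ℕ} {X : Type*} [TopologicalSpace X] [ChartedSpace (Cn n) X]

theorem isSmoothCurve_const (f : SmoothFn n X) : IsSmoothCurve fun _ => f :=
  f.contMDiff.comp contMDiff_snd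

theorem isSmoothCurve_line (φ ψ : SmoothFn n X) : IsSmoothCurve fun t => φ + t • ψ := by
  have h1 : ContMDiff (𝓘(ℝ, ℝ).prod 𝓘(ℝ, Cn n)) 𝓘(ℝ, ℝ) ∞ fun p : ℝ × X => φ p.2 :=
    isSmoothCurve_const φ
  have h2 : ContMDiff (𝓘(ℝ, ℝ).prod 𝓘(ℝ, Cn n)) 𝓘(ℝ, ℝ) ∞ fun p : ℝ × X => ψ p.2 :=
    isSmoothCurve_const ψ
  have h3 : ContMDiff (𝓘(ℝ, ℝ).prod 𝓘(ℝ, Cn n)) 𝓘(ℝ, ℝ) ∞ fun p : ℝ × X => p.1 := contMDiff_fst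
  exact h1.add (h3.smul h2)

theorem mfderiv_eq_fderiv_chart (f : SmoothFn n X) (x : X) :
    (mfderiv 𝓘(ℝ, Cn n) 𝓘(ℝ, ℝ) f x : Cn n →L[ℝ] ℝ) =
      fderiv ℝ (f ∘ (chartAt (Cn n) x).symm) (chartAt (Cn n) x x) := by
  rw [(f.contMDiff.mdifferentiable (by simp) x).mfderiv]
  simp [writtenInExtChartAt, extChartAt, fderivWithin_univ]
  rfl

variable [IsManifold 𝓘(ℂ, Cn n) ω X]

theorem contDiffOn_localForm_param {η : TwoForm n X} (hη : IsKahlerForm η)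
    {e : OpenPartialHomeomorph X (Cn n)} (he : e ∈ atlas (Cn n) X) {c : ℝ → SmoothFn n X}
    (hc : IsSmoothCurve c) :
    ContDiffOn ℝ ∞ (fun p : ℝ × Cn n => localForm η (c p.1) e p.2) (Set.univ ×ˢ e.target) :=
  ((hη.smooth e he).comp contDiffOn_snd fun _ hp => hp.2).add
    (contDiffOn_iddbarCn_param (F := fun s y => c s (e.symm y)) e.open_target
      (contDiffOn_curve_chart he hc))

theorem contDiffOn_localForm {η : TwoForm n X} (hη : IsKahlerForm η)
    {e : OpenPartialHomeomorph X (Cn n)} (he : e ∈ atlas (Cn n) X) (φ : SmoothFn n X) :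
    ContDiffOn ℝ ∞ (localForm η φ e) e.target :=
  contDiffOn_of_param (F := localForm η φ e)
    (contDiffOn_localForm_param hη he (c := fun _ => φ) (isSmoothCurve_const φ))

theorem extDeriv_localForm {η : TwoForm n X} (hη : IsKahlerForm η)
    {e : OpenPartialHomeomorph X (Cn n)} (he : e ∈ atlas (Cn n) X) (φ : SmoothFn n X) {y : Cn n}
    (hy : y ∈ e.target) : extDeriv (localForm η φ e) y = 0 := by
  have h1 : ContDiffAt ℝ ∞ (η.inChart e) y :=
    (hη.smooth e he).contDiffAt (e.open_target.mem_nhds hy)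
  have h2 : ContDiffOn ℝ ∞ (iddbarCn (φ ∘ e.symm)) e.target :=
    contDiffOn_of_param (F := iddbarCn (φ ∘ e.symm)) (contDiffOn_iddbarCn_param (F := fun _ => φ ∘ e.symm) e.open_target
      (contDiffOn_curve_chart he (isSmoothCurve_const φ)))
  have h3 : ContDiffAt ℝ ∞ (iddbarCn (φ ∘ e.symm)) y := h2.contDiffAt (e.open_target.mem_nhds hy)
  have : localForm η φ e = η.inChart e + iddbarCn (φ ∘ e.symm) := rfl
  rw [this, extDeriv_add (h1.differentiableAt (by simp)) (h3.differentiableAt (by simp)),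
    hη.closed e he y hy, extDeriv_iddbarCn (contDiffAt_chart he φ hy), add_zero]

theorem localForm_mulI {η : TwoForm n X} (hη : IsKahlerForm η)
    {e : OpenPartialHomeomorph X (Cn n)} (he : e ∈ atlas (Cn n) X) (φ : SmoothFn n X) {y : Cn n}
    (hy : y ∈ e.target) (v w : Cn n) :
    localForm η φ e y ![mulI n v, mulI n w] = localForm η φ e y ![v, w] := by
  have h1 : η.inChart e y ![mulI n v, mulI n w] = η.inChart e y ![v, w] := by
    have hx := e.map_target hy
    have h := inChart_eq he hx η
    rw [e.right_inv hy] at h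
    have hJ : ∀ u, jac e (chartAt (Cn n) (e.symm y)) (e.symm y) (mulI n u) =
        mulI n (jac e (chartAt (Cn n) (e.symm y)) (e.symm y) u) := fun u =>
      congrArg (fun L : Cn n →L[ℝ] Cn n => L u) (fderiv_comp_mulI
        (differentiableAt_transition he (chart_mem_atlas (Cn n) _) hx (mem_chart_source _ _)))
    rw [h, pull_apply_pair, pull_apply_pair, hJ, hJ]
    exact hη.type_one_one (e.symm y) _ _
  have h2 := iddbarCn_mulI (contDiffAt_chart he φ hy) v w
  simp only [localForm, ContinuousAlternatingMap.add_apply, h1, h2]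

theorem localForm_add_smul (η : TwoForm n X) (φ ψ : SmoothFn n X)
    {e : OpenPartialHomeomorph X (Cn n)} (he : e ∈ atlas (Cn n) X) {y : Cn n} (hy : y ∈ e.target)
    (t : ℝ) : localForm η (φ + t • ψ) e y =
      localForm η φ e y + t • iddbarCn (ψ ∘ e.symm) y := by
  have := iddbarCn_add_smul (contDiffAt_chart he φ hy) (contDiffAt_chart he ψ hy) t
  rw [localForm, localForm, add_assoc, ← this]
  rfl

/-- In the preferred chart at the point this is the linear algebra of
`hamiltonianVector_mul_volCoeff`; passing to the chart `e` multiplies both sides by the same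
Jacobian determinant. The right side no longer involves a choice of Hamiltonian vectors, so its
smoothness is plain. -/
theorem poissonBracket_mul_wedgePow (η : TwoForm n X) (φ f g : SmoothFn n X)
    {e : OpenPartialHomeomorph X (Cn n)} (he : e ∈ atlas (Cn n) X) {y : Cn n} (hy : y ∈ e.target)
    (h : Nondeg (localForm η φ e y)) :
    poissonBracket (perturbed η φ) f g (e.symm y) * wedgePow n (perturbed η φ (e.symm y))
      (fun k => chartFrame e y (stdFrame n k)) =
    dVol n (localForm η φ e y) (wedge (fderiv ℝ (f ∘ e.symm) y) (fderiv ℝ (g ∘ e.symm) y)) := by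
  obtain ⟨x, hx, rfl⟩ : ∃ x ∈ e.source, y = e x :=
    ⟨e.symm y, e.map_target hy, (e.right_inv hy).symm⟩
  have hx' : e.symm (e x) = x := e.left_inv hx
  have hN : Nondeg (TwoForm.val (perturbed η φ) x) := (nondeg_localForm_iff η φ he hx).1 h
  have hmem := chart_mem_atlas (Cn n) x
  rw [localForm_eq η φ he hx, fderiv_chart_eq he hmem hx (mem_chart_source _ x),
    fderiv_chart_eq he hmem hx (mem_chart_source _ x), ← pull_wedge, dVol_pull,
    ← mfderiv_eq_fderiv_chart, ← mfderiv_eq_fderiv_chart]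
  have h1 := hamiltonianVector_mul_volCoeff hN (mfderiv 𝓘(ℝ, Cn n) 𝓘(ℝ, ℝ) f x)
    (mfderiv 𝓘(ℝ, Cn n) 𝓘(ℝ, ℝ) g x)
  have h2 : wedgePow n (TwoForm.val (perturbed η φ) (e.symm (e x)))
      (fun k => (chartFrame e (e x) : Cn n →L[ℝ] Cn n) (stdFrame n k)) =
      (jac e (chartAt (Cn n) x) x).det * volCoeff n (TwoForm.val (perturbed η φ) x) := by
    rw [chartFrame_eq he hy, hx']
    exact wedgePow_apply_frame _ _
  have h3 : poissonBracket (perturbed η φ) f g (e.symm (e x)) =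
      poissonBracket (perturbed η φ) f g x := by rw [hx']
  refine (congrArg₂ (· * ·) h3 h2).trans ?_
  rw [← h1]
  exact mul_left_comm _ _ _

end ChartParameters

/-! ### The densities of `θ`, of its variation and of the quartic form -/

section Densities

variable {n : ℕ} {X : Type*} [TopologicalSpace X] [ChartedSpace (Cn n) X]

/-- The density of `h {f, g} ω_φ^n`. -/
def bracketDensity (η : TwoForm n X) (φ f g h : SmoothFn n X) (c : X) (y : Cn n) : ℝ :=
  h ((chartAt (Cn n) c).symm y) * dVol n (localForm η φ (chartAt (Cn n) c) y)
    (wedge (fderiv ℝ (f ∘ (chartAt (Cn n) c).symm) y) (fderiv ℝ (g ∘ (chartAt (Cn n) c).symm) y))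

/-- The derivative of `bracketDensity` when `φ` varies in the direction `ψ`. -/
def variationDensity (η : TwoForm n X) (φ ψ f g h : SmoothFn n X) (c : X) (y : Cn n) : ℝ :=
  h ((chartAt (Cn n) c).symm y) * ddVol n (localForm η φ (chartAt (Cn n) c) y)
    (iddbarCn (ψ ∘ (chartAt (Cn n) c).symm) y)
    (wedge (fderiv ℝ (f ∘ (chartAt (Cn n) c).symm) y) (fderiv ℝ (g ∘ (chartAt (Cn n) c).symm) y))

/-- The density of `dh ∧ ½ d^c ψ ∧ df ∧ dg ∧ ω_φ^(n-2)`, up to a constant. -/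
def quarticDensity (η : TwoForm n X) (φ ψ f g h : SmoothFn n X) (c : X) (y : Cn n) : ℝ :=
  quartic (localForm η φ (chartAt (Cn n) c) y) (fderiv ℝ (h ∘ (chartAt (Cn n) c).symm) y)
    (halfDc (ψ ∘ (chartAt (Cn n) c).symm) y) (fderiv ℝ (f ∘ (chartAt (Cn n) c).symm) y)
    (fderiv ℝ (g ∘ (chartAt (Cn n) c).symm) y)

theorem IsDensity.congr {D D' : X → Cn n → ℝ} (hD : IsDensity D)
    (h : ∀ c, ∀ y ∈ (chartAt (Cn n) c).target, D c y = D' c y) : IsDensity D' := by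
  intro c c' x hx hx'
  rw [← h c _ ((chartAt (Cn n) c).map_source hx), ← h c' _ ((chartAt (Cn n) c').map_source hx')]
  exact hD c c' x hx hx'

variable [IsManifold 𝓘(ℂ, Cn n) ω X]

theorem isDensity_bracketDensity (η : TwoForm n X) (φ f g h : SmoothFn n X) :
    IsDensity (bracketDensity η φ f g h) := by
  intro c c' x hx hx'
  have hc := chart_mem_atlas (Cn n) c
  have hc' := chart_mem_atlas (Cn n) c'
  rw [bracketDensity, bracketDensity, localForm_transition η φ hc hc' hx hx',
    fderiv_chart_eq hc hc' hx hx' f, fderiv_chart_eq hc hc' hx hx' g, ← pull_wedge, dVol_pull,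
    OpenPartialHomeomorph.left_inv _ hx, OpenPartialHomeomorph.left_inv _ hx']
  ring

theorem isDensity_variationDensity (η : TwoForm n X) (φ ψ f g h : SmoothFn n X) :
    IsDensity (variationDensity η φ ψ f g h) := by
  intro c c' x hx hx'
  have hc := chart_mem_atlas (Cn n) c
  have hc' := chart_mem_atlas (Cn n) c'
  rw [variationDensity, variationDensity, localForm_transition η φ hc hc' hx hx',
    iddbarCn_chart_eq hc hc' hx hx',
    fderiv_chart_eq hc hc' hx hx' f, fderiv_chart_eq hc hc' hx hx' g, ← pull_wedge, ddVol_pull,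
    OpenPartialHomeomorph.left_inv _ hx, OpenPartialHomeomorph.left_inv _ hx']
  ring

theorem isDensity_quarticDensity (η : TwoForm n X) (φ ψ f g h : SmoothFn n X) :
    IsDensity (quarticDensity η φ ψ f g h) := by
  intro c c' x hx hx'
  have hc := chart_mem_atlas (Cn n) c
  have hc' := chart_mem_atlas (Cn n) c'
  rw [quarticDensity, quarticDensity, localForm_transition η φ hc hc' hx hx',
    fderiv_chart_eq hc hc' hx hx' f, fderiv_chart_eq hc hc' hx hx' g,
    fderiv_chart_eq hc hc' hx hx' h, halfDc_chart_eq hc hc' hx hx', quartic, ← pull_wedge,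
    ← pull_wedge, ddVol_pull, quartic]

theorem contDiffOn_fderiv_curve {e : OpenPartialHomeomorph X (Cn n)} (he : e ∈ atlas (Cn n) X)
    {c : ℝ → SmoothFn n X} (hc : IsSmoothCurve c) :
    ContDiffOn ℝ ∞ (fun p : ℝ × Cn n => fderiv ℝ (c p.1 ∘ e.symm) p.2) (Set.univ ×ˢ e.target) :=
  contDiffOn_fderiv_param (F := fun s => c s ∘ e.symm) e.open_target (contDiffOn_curve_chart he hc)

theorem contDiffOn_fderiv_chart {e : OpenPartialHomeomorph X (Cn n)} (he : e ∈ atlas (Cn n) X)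
    (f : SmoothFn n X) : ContDiffOn ℝ ∞ (fderiv ℝ (f ∘ e.symm)) e.target :=
  contDiffOn_of_param (F := fderiv ℝ (f ∘ e.symm))
    (contDiffOn_fderiv_curve he (c := fun _ => f) (isSmoothCurve_const f))

theorem contDiffOn_bracketDensity_param {η : TwoForm n X} (hη : IsKahlerForm η)
    {φ f g h : ℝ → SmoothFn n X} (hφ : IsSmoothCurve φ) (hf : IsSmoothCurve f)
    (hg : IsSmoothCurve g) (hh : IsSmoothCurve h) (c : X) :
    ContDiffOn ℝ ∞ (fun p : ℝ × Cn n => bracketDensity η (φ p.1) (f p.1) (g p.1) (h p.1) c p.2)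
      (Set.univ ×ˢ (chartAt (Cn n) c).target) := by
  have he := chart_mem_atlas (Cn n) c
  have h1 := contDiff_dVol.comp_contDiffOn (contDiffOn_localForm_param hη he hφ)
  have h2 := ((wedge (n := n)).contDiff.comp_contDiffOn (contDiffOn_fderiv_curve he hf)).clm_apply
    (contDiffOn_fderiv_curve he hg)
  exact (contDiffOn_curve_chart he hh).mul (h1.clm_apply h2)

theorem continuousOn_bracketDensity {η : TwoForm n X} (hη : IsKahlerForm η)
    (φ f g h : SmoothFn n X) (c : X) :
    ContinuousOn (bracketDensity η φ f g h c) (chartAt (Cn n) c).target :=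
  (contDiffOn_of_param (F := bracketDensity η φ f g h c)
    (contDiffOn_bracketDensity_param hη (φ := fun _ => φ) (f := fun _ => f) (g := fun _ => g)
      (h := fun _ => h) (isSmoothCurve_const φ) (isSmoothCurve_const f) (isSmoothCurve_const g)
      (isSmoothCurve_const h) c)).continuousOn

theorem contDiffOn_halfDc_chart {e : OpenPartialHomeomorph X (Cn n)} (he : e ∈ atlas (Cn n) X)
    (f : SmoothFn n X) : ContDiffOn ℝ ∞ (halfDc (f ∘ e.symm)) e.target :=
  contDiffOn_of_param (F := halfDc (f ∘ e.symm))
    (contDiffOn_halfDc_param (F := fun _ => f ∘ e.symm) e.open_target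
      (contDiffOn_curve_chart he (c := fun _ => f) (isSmoothCurve_const f)))

theorem contDiffOn_iddbarCn_chart {e : OpenPartialHomeomorph X (Cn n)} (he : e ∈ atlas (Cn n) X)
    (f : SmoothFn n X) : ContDiffOn ℝ ∞ (iddbarCn (f ∘ e.symm)) e.target :=
  contDiffOn_of_param (F := iddbarCn (f ∘ e.symm))
    (contDiffOn_iddbarCn_param (F := fun _ => f ∘ e.symm) e.open_target
      (contDiffOn_curve_chart he (c := fun _ => f) (isSmoothCurve_const f)))

theorem contDiffOn_wedge {U : Set (Cn n)} {a b : Cn n → Cov n} (ha : ContDiffOn ℝ ∞ a U)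
    (hb : ContDiffOn ℝ ∞ b U) : ContDiffOn ℝ ∞ (fun y => wedge (a y) (b y)) U :=
  ((wedge (n := n)).contDiff.comp_contDiffOn ha).clm_apply hb

theorem contDiffOn_quartic {U : Set (Cn n)} {W : Cn n → Two n} {a b c d : Cn n → Cov n}
    (hW : ContDiffOn ℝ ∞ W U) (ha : ContDiffOn ℝ ∞ a U) (hb : ContDiffOn ℝ ∞ b U)
    (hc : ContDiffOn ℝ ∞ c U) (hd : ContDiffOn ℝ ∞ d U) :
    ContDiffOn ℝ ∞ (fun y => quartic (W y) (a y) (b y) (c y) (d y)) U :=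
  ((contDiff_ddVol.comp_contDiffOn hW).clm_apply (contDiffOn_wedge ha hb)).clm_apply
    (contDiffOn_wedge hc hd)

theorem continuousOn_variationDensity {η : TwoForm n X} (hη : IsKahlerForm η)
    (φ ψ f g h : SmoothFn n X) (c : X) :
    ContinuousOn (variationDensity η φ ψ f g h c) (chartAt (Cn n) c).target := by
  have he := chart_mem_atlas (Cn n) c
  have h1 := (contDiff_ddVol.comp_contDiffOn (contDiffOn_localForm hη he φ)).clm_apply
    (contDiffOn_iddbarCn_chart he ψ)
  have h2 := h1.clm_apply
    (contDiffOn_wedge (contDiffOn_fderiv_chart he f) (contDiffOn_fderiv_chart he g))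
  exact ((contDiffOn_chart he h).mul h2).continuousOn

theorem continuousOn_quarticDensity {η : TwoForm n X} (hη : IsKahlerForm η)
    (φ ψ f g h : SmoothFn n X) (c : X) :
    ContinuousOn (quarticDensity η φ ψ f g h c) (chartAt (Cn n) c).target := by
  have he := chart_mem_atlas (Cn n) c
  exact (contDiffOn_quartic (contDiffOn_localForm hη he φ) (contDiffOn_fderiv_chart he h)
    (contDiffOn_halfDc_chart he ψ) (contDiffOn_fderiv_chart he f)
    (contDiffOn_fderiv_chart he g)).continuousOn

theorem nondeg_localForm_of_mem_potentials {η : TwoForm n X} {φ : SmoothFn n X}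
    (hφ : φ ∈ potentials η) {e : OpenPartialHomeomorph X (Cn n)} (he : e ∈ atlas (Cn n) X)
    {y : Cn n} (hy : y ∈ e.target) : Nondeg (localForm η φ e y) := by
  have := (nondeg_localForm_iff η φ he (e.map_target hy)).2 (nondeg_of_mem_potentials hφ _)
  rwa [e.right_inv hy] at this

variable [CompactSpace X] [T2Space X]

/-! ### Stokes' theorem -/

/-- Identifying the divergence with a known density supplies the transformation law needed by
`chartIntegral_divergence`, so none has to be checked for `Z` itself. -/
theorem chartIntegral_eq_zero_of_divergence {D : SmoothFn n X → X → Cn n → ℝ}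
    (hD : ∀ h, IsDensity (D h)) (Z : X → Fin n × Fin 2 → Cn n → ℝ)
    (hZ : ∀ c i, ContDiffOn ℝ ∞ (Z c i) (chartAt (Cn n) c).target)
    (hdiv : ∀ h c, ∀ y ∈ (chartAt (Cn n) c).target, ∑ i,
      fderiv ℝ (fun y => h ((chartAt (Cn n) c).symm y) * Z c i y) y (stdBasis n i) = D h c y)
    (h : SmoothFn n X) : chartIntegral (D h) = 0 := by
  rw [← chartIntegral_divergence Z hZ
    (fun h => (hD h).congr fun c y hy => (hdiv h c y hy).symm) h]
  exact chartIntegral_congr fun c y hy => (hdiv h c y (partitionSupport_subset c hy)).symm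

/-- The integrand is, up to a constant, the exact form `df ∧ du ∧ ω_φ^(n-1)`. -/
theorem chartIntegral_bracketDensity_one {η : TwoForm n X} (hη : IsKahlerForm η) {φ : SmoothFn n X}
    (hφ : φ ∈ potentials η) (f u : SmoothFn n X) :
    chartIntegral (bracketDensity η φ f u 1) = 0 := by
  refine chartIntegral_eq_zero_of_divergence (D := fun u => bracketDensity η φ f u 1)
    (fun u => isDensity_bracketDensity η φ f u 1)
    (fun c i y => dVol n (localForm η φ (chartAt (Cn n) c) y)
      (wedge (fderiv ℝ (f ∘ (chartAt (Cn n) c).symm) y) (dualCov i))) ?_ ?_ u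
  · intro c i
    have he := chart_mem_atlas (Cn n) c
    exact (contDiff_dVol.comp_contDiffOn (contDiffOn_localForm hη he φ)).clm_apply
      (contDiffOn_wedge (contDiffOn_fderiv_chart he f) contDiffOn_const)
  · intro u c y hy
    have he := chart_mem_atlas (Cn n) c
    have hy' := (chartAt (Cn n) c).open_target.mem_nhds hy
    have h2 : (2 : ℕ∞ω) ≤ ∞ := WithTop.coe_le_coe.2 le_top
    refine (sum_deriv_dVol (u := u ∘ (chartAt (Cn n) c).symm)
      (((contDiffOn_localForm hη he φ).contDiffAt hy').differentiableAt (by simp))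
      (extDeriv_localForm hη he φ hy) (nondeg_localForm_of_mem_potentials hφ he hy)
      ((contDiffAt_chart he f hy).of_le h2)
      ((contDiffAt_chart he u hy).differentiableAt (by simp))).trans ?_
    simp [bracketDensity]

/-- Leibniz rule in `∫ df ∧ d(gh) ∧ ω_φ^(n-1) = 0`. -/
theorem chartIntegral_bracketDensity_swap {η : TwoForm n X} (hη : IsKahlerForm η) {φ : SmoothFn n X}
    (hφ : φ ∈ potentials η) (f g h : SmoothFn n X) :
    chartIntegral (bracketDensity η φ f g h) = - chartIntegral (bracketDensity η φ f h g) := by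
  have h1 := chartIntegral_bracketDensity_one hη hφ f (g * h)
  rw [eq_neg_iff_add_eq_zero, ← h1, ← chartIntegral_add (continuousOn_bracketDensity hη φ f g h)
    (continuousOn_bracketDensity hη φ f h g)]
  refine chartIntegral_congr fun c y hy => ?_
  have he := chart_mem_atlas (Cn n) c
  have hy := partitionSupport_subset c hy
  have hg := (contDiffAt_chart he g hy).differentiableAt (by simp)
  have hh := (contDiffAt_chart he h hy).differentiableAt (by simp)
  have hmul : fderiv ℝ (⇑(g * h) ∘ (chartAt (Cn n) c).symm) y =
      g ((chartAt (Cn n) c).symm y) • fderiv ℝ (h ∘ (chartAt (Cn n) c).symm) y +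
      h ((chartAt (Cn n) c).symm y) • fderiv ℝ (g ∘ (chartAt (Cn n) c).symm) y :=
    fderiv_mul hg hh
  simp only [bracketDensity, hmul, map_add, map_smul, smul_eq_mul]
  simp
  ring

/-- Integration by parts: in `i∂∂̄ψ = d(½ d^c ψ)` the outer `d` is moved onto `h`, everything else
being closed. -/
theorem chartIntegral_variationDensity {η : TwoForm n X} (hη : IsKahlerForm η) {φ : SmoothFn n X}
    (hφ : φ ∈ potentials η) (ψ f g h : SmoothFn n X) :
    chartIntegral (variationDensity η φ ψ f g h) = - chartIntegral (quarticDensity η φ ψ f g h) := by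
  rw [eq_neg_iff_add_eq_zero, ← chartIntegral_add (continuousOn_variationDensity hη φ ψ f g h)
    (continuousOn_quarticDensity hη φ ψ f g h)]
  refine chartIntegral_eq_zero_of_divergence
    (D := fun h c y => variationDensity η φ ψ f g h c y + quarticDensity η φ ψ f g h c y)
    (fun h c c' x hx hx' => ?_)
    (fun c i y => quartic (localForm η φ (chartAt (Cn n) c) y) (dualCov i)
      (halfDc (ψ ∘ (chartAt (Cn n) c).symm) y) (fderiv ℝ (f ∘ (chartAt (Cn n) c).symm) y)
      (fderiv ℝ (g ∘ (chartAt (Cn n) c).symm) y)) ?_ ?_ h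
  · dsimp only
    rw [isDensity_variationDensity η φ ψ f g h c c' x hx hx',
      isDensity_quarticDensity η φ ψ f g h c c' x hx hx', mul_add]
  · intro c i
    have he := chart_mem_atlas (Cn n) c
    exact contDiffOn_quartic (contDiffOn_localForm hη he φ) contDiffOn_const
      (contDiffOn_halfDc_chart he ψ) (contDiffOn_fderiv_chart he f) (contDiffOn_fderiv_chart he g)
  · intro h c y hy
    have he := chart_mem_atlas (Cn n) c
    have hy' := (chartAt (Cn n) c).open_target.mem_nhds hy
    have h2 : (2 : ℕ∞ω) ≤ ∞ := WithTop.coe_le_coe.2 le_top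
    refine (sum_deriv_ddVol (h := h ∘ (chartAt (Cn n) c).symm)
      (((contDiffOn_localForm hη he φ).contDiffAt hy').differentiableAt (by simp))
      (extDeriv_localForm hη he φ hy) (nondeg_localForm_of_mem_potentials hφ he hy)
      ((contDiffAt_chart he f hy).of_le h2) ((contDiffAt_chart he g hy).of_le h2)
      ((contDiffAt_chart he h hy).differentiableAt (by simp))
      (differentiableAt_halfDc (contDiffAt_chart he ψ hy))).trans ?_
    rw [← iddbarCn_eq_extDeriv, add_comm]
    rfl

/-- The integrated form of the closedness of `θ`. -/
theorem alternating_sum_chartIntegral_variationDensity {η : TwoForm n X} (hη : IsKahlerForm η) {φ : SmoothFn n X}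
    (hφ : φ ∈ potentials η) (ξ : Fin 4 → SmoothFn n X) :
    chartIntegral (variationDensity η φ (ξ 0) (ξ 1) (ξ 2) (ξ 3)) -
      chartIntegral (variationDensity η φ (ξ 1) (ξ 0) (ξ 2) (ξ 3)) +
      chartIntegral (variationDensity η φ (ξ 2) (ξ 0) (ξ 1) (ξ 3)) -
      chartIntegral (variationDensity η φ (ξ 3) (ξ 0) (ξ 1) (ξ 2)) = 0 := by
  have hc := continuousOn_quarticDensity hη φ
  have h0 : chartIntegral (fun (c : X) (y : Cn n) =>
      (quarticDensity η φ (ξ 0) (ξ 1) (ξ 2) (ξ 3) c y +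
        -1 * quarticDensity η φ (ξ 1) (ξ 0) (ξ 2) (ξ 3) c y) +
      (quarticDensity η φ (ξ 2) (ξ 0) (ξ 1) (ξ 3) c y +
        -1 * quarticDensity η φ (ξ 3) (ξ 0) (ξ 1) (ξ 2) c y)) = 0 := by
    have hz : chartIntegral (fun (_ : X) (_ : Cn n) => (0 : ℝ)) = 0 := by simp [chartIntegral]
    rw [← hz]
    refine chartIntegral_congr fun c y hy => ?_
    have he := chart_mem_atlas (Cn n) c
    have hy := partitionSupport_subset c hy
    have key := quartic_alternating_sum (nondeg_localForm_of_mem_potentials hφ he hy)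
      (localForm_mulI hη he φ hy) (fderiv ℝ (ξ 0 ∘ (chartAt (Cn n) c).symm) y)
      (fderiv ℝ (ξ 1 ∘ (chartAt (Cn n) c).symm) y) (fderiv ℝ (ξ 2 ∘ (chartAt (Cn n) c).symm) y)
      (fderiv ℝ (ξ 3 ∘ (chartAt (Cn n) c).symm) y)
    have hs : ∀ (W : Two n) (r : ℝ) (a b c d : Cov n),
        quartic W a (r • b) c d = r * quartic W a b c d := fun W r a b c d => by
      simp [quartic]
    simp only [quarticDensity, halfDc, hs]
    -- The factor is the one in `halfDc`, since `½ d^c ψ = -½ dψ ∘ J`.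
    linear_combination (-2⁻¹ : ℝ) * key
  have hn : ∀ ψ f g h (c : X), ContinuousOn (fun y => -1 * quarticDensity η φ ψ f g h c y)
      (chartAt (Cn n) c).target := fun ψ f g h c => continuousOn_const.mul (hc ψ f g h c)
  have hp : ∀ ψ f g h ψ' f' g' h' (c : X), ContinuousOn (fun y => quarticDensity η φ ψ f g h c y +
      -1 * quarticDensity η φ ψ' f' g' h' c y) (chartAt (Cn n) c).target :=
    fun ψ f g h ψ' f' g' h' c => (hc ψ f g h c).add (hn ψ' f' g' h' c)
  rw [chartIntegral_add (hp _ _ _ _ _ _ _ _) (hp _ _ _ _ _ _ _ _),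
    chartIntegral_add (hc _ _ _ _) (hn _ _ _ _), chartIntegral_add (hc _ _ _ _) (hn _ _ _ _),
    chartIntegral_const_mul, chartIntegral_const_mul] at h0
  simp only [chartIntegral_variationDensity hη hφ]
  linarith

end Densities

section Theta

variable {n : ℕ} {X : Type*} [TopologicalSpace X] [ChartedSpace (Cn n) X]
  [IsManifold 𝓘(ℂ, Cn n) ω X] [CompactSpace X] [T2Space X]

/-! ### Integrals depending on a parameter -/

theorem contDiff_indicator_partition {D : ℝ → X → Cn n → ℝ} (c : X)
    (hD : ContDiffOn ℝ ∞ (fun p : ℝ × Cn n => D p.1 c p.2)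
      (Set.univ ×ˢ (chartAt (Cn n) c).target)) :
    ContDiff ℝ ∞ (fun p : ℝ × Cn n => (chartAt (Cn n) c).target.indicator
      (fun y => chartPartition n X c ((chartAt (Cn n) c).symm y) * D p.1 c y) p.2) := by
  have h := contDiff_indicator (K := (Set.univ : Set ℝ) ×ˢ partitionSupport n c)
    (isOpen_univ.prod (chartAt (Cn n) c).open_target)
    (isClosed_univ.prod (isCompact_partitionSupport c).isClosed)
    (Set.prod_mono_right (partitionSupport_subset c))
    (((contDiffOn_chart (chart_mem_atlas (Cn n) c) (chartPartition n X c)).comp contDiffOn_snd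
      fun _ hp => hp.2).mul hD) (fun p hp hp' => by
      have : p.2 ∉ partitionSupport n c := fun h => hp' ⟨trivial, h⟩
      simp [chartPartition_symm_eq_zero hp.2 this])
  convert h using 1
  funext p
  by_cases hp : p.2 ∈ (chartAt (Cn n) c).target
  · rw [Set.indicator_of_mem hp, Set.indicator_of_mem (show p ∈ Set.univ ×ˢ _ from ⟨trivial, hp⟩)]
    rfl
  · rw [Set.indicator_of_notMem hp, Set.indicator_of_notMem fun h => hp h.2]

theorem indicator_partition_eq_zero {D : X → Cn n → ℝ} {c : X} {y : Cn n}
    (hy : y ∉ partitionSupport n c) : (chartAt (Cn n) c).target.indicator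
      (fun y => chartPartition n X c ((chartAt (Cn n) c).symm y) * D c y) y = 0 := by
  by_cases h : y ∈ (chartAt (Cn n) c).target
  · rw [Set.indicator_of_mem h, chartPartition_symm_eq_zero h hy, zero_mul]
  · rw [Set.indicator_of_notMem h]

theorem chartIntegral_eq_sum_indicator (D : X → Cn n → ℝ) : chartIntegral D =
    ∑ c ∈ partitionIndex n X, ∫ y, (chartAt (Cn n) c).target.indicator
      (fun y => chartPartition n X c ((chartAt (Cn n) c).symm y) * D c y) y := by
  rw [chartIntegral_eq_sum]
  exact Finset.sum_congr rfl fun c _ =>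
    (integral_indicator (chartAt (Cn n) c).open_target.measurableSet).symm

theorem contDiff_chartIntegral {D : ℝ → X → Cn n → ℝ}
    (hD : ∀ c, ContDiffOn ℝ ∞ (fun p : ℝ × Cn n => D p.1 c p.2)
      (Set.univ ×ˢ (chartAt (Cn n) c).target)) : ContDiff ℝ ∞ fun t => chartIntegral (D t) := by
  simp only [chartIntegral_eq_sum_indicator]
  refine ContDiff.sum fun c _ => ?_
  rw [← contDiffOn_univ]
  exact contDiffOn_integral isOpen_univ (isCompact_partitionSupport c)
    (F := fun t => (chartAt (Cn n) c).target.indicator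
      (fun y => chartPartition n X c ((chartAt (Cn n) c).symm y) * D t c y))
    (contDiff_indicator_partition c (hD c)).contDiffOn
    fun t _ y hy => indicator_partition_eq_zero hy

theorem hasDerivAt_chartIntegral {D : ℝ → X → Cn n → ℝ}
    (hD : ∀ c, ContDiffOn ℝ ∞ (fun p : ℝ × Cn n => D p.1 c p.2)
      (Set.univ ×ˢ (chartAt (Cn n) c).target)) (t : ℝ) :
    HasDerivAt (fun t => chartIntegral (D t))
      (chartIntegral fun c y => deriv (fun t => D t c y) t) t := by
  simp only [chartIntegral_eq_sum_indicator]
  refine HasDerivAt.fun_sum fun c _ => ?_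
  have h := hasDerivAt_integral (μ := volume) isOpen_univ (isCompact_partitionSupport c)
    (F := fun t => (chartAt (Cn n) c).target.indicator
      (fun y => chartPartition n X c ((chartAt (Cn n) c).symm y) * D t c y))
    (contDiff_indicator_partition c (hD c)).contDiffOn
    (fun t _ y hy => indicator_partition_eq_zero hy) (Set.mem_univ t)
  refine h.congr_deriv (integral_congr_ae (Filter.Eventually.of_forall fun y => ?_))
  by_cases hy : y ∈ (chartAt (Cn n) c).target
  · simp only [Set.indicator_of_mem hy]
    exact deriv_const_mul_field _
  · simp [Set.indicator_of_notMem hy]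

/-! ### The form `θ` in charts -/

/-- Nondegeneracy on the supports of the partition is assumed in place of positivity, so that the
formula also holds at neighbouring parameters without openness of `potentials`. -/
theorem theta_eq_chartIntegral {η : TwoForm n X} {φ : SmoothFn n X}
    (h : ∀ c : X, ∀ y ∈ partitionSupport n c, Nondeg (localForm η φ (chartAt (Cn n) c) y))
    (ξ : Fin 3 → SmoothFn n X) :
    theta η φ ξ = chartIntegral (bracketDensity η φ (ξ 0) (ξ 1) (ξ 2)) := by
  refine Eq.trans (b := chartIntegral fun c y =>
    (poissonBracket (perturbed η φ) (ξ 0) (ξ 1) ((chartAt (Cn n) c).symm y) *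
      ξ 2 ((chartAt (Cn n) c).symm y)) *
      wedgePow n (perturbed η φ ((chartAt (Cn n) c).symm y))
        (fun k => chartFrame (chartAt (Cn n) c) y (stdFrame n k))) rfl ?_
  refine chartIntegral_congr fun c y hy => ?_
  rw [bracketDensity, ← poissonBracket_mul_wedgePow η φ (ξ 0) (ξ 1) (chart_mem_atlas (Cn n) c)
    (partitionSupport_subset c hy) (h c y hy)]
  ring

/-- Nondegeneracy is an open condition, so it persists uniformly on each compact support, and only
finitely many supports are nonempty. -/
theorem eventually_nondeg {η : TwoForm n X} (hη : IsKahlerForm η) {φ : ℝ → SmoothFn n X}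
    (hφ : IsSmoothCurve φ) {t : ℝ} (ht : φ t ∈ potentials η) :
    ∀ᶠ s in 𝓝 t, ∀ c : X, ∀ y ∈ partitionSupport n c,
      Nondeg (localForm η (φ s) (chartAt (Cn n) c) y) := by
  have h1 : ∀ c ∈ partitionIndex n X, ∀ᶠ s in 𝓝 t, ∀ y ∈ partitionSupport n c,
      Nondeg (localForm η (φ s) (chartAt (Cn n) c) y) := fun c _ => by
    refine (isCompact_partitionSupport c).eventually_forall_of_forall_eventually fun y hy => ?_
    have he := chart_mem_atlas (Cn n) c
    have hy := partitionSupport_subset c hy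
    have hcont := ((contDiffOn_localForm_param hη he hφ).contDiffAt (x := (t, y))
      ((isOpen_univ.prod (chartAt (Cn n) c).open_target).mem_nhds ⟨trivial, hy⟩)).continuousAt
    exact hcont.eventually
      (isOpen_nondeg.mem_nhds (nondeg_localForm_of_mem_potentials ht he hy))
  filter_upwards [(Filter.eventually_all_finset _).2 h1] with s hs c y hy
  by_cases hc : c ∈ partitionIndex n X
  · exact hs c hc y hy
  · obtain ⟨x, hx, -⟩ := hy
    have : tsupport (chartPartition n X c) = ∅ := by
      rw [tsupport_eq_empty_iff]
      exact funext fun x => chartPartition_eq_zero hc x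
    rw [this] at hx
    exact hx.elim

theorem theta_of_mem_potentials {η : TwoForm n X} {φ : SmoothFn n X} (hφ : φ ∈ potentials η)
    (ξ : Fin 3 → SmoothFn n X) :
    theta η φ ξ = chartIntegral (bracketDensity η φ (ξ 0) (ξ 1) (ξ 2)) :=
  theta_eq_chartIntegral (fun c _ hy => nondeg_localForm_of_mem_potentials hφ
    (chart_mem_atlas (Cn n) c) (partitionSupport_subset c hy)) ξ

theorem contDiffAt_theta {η : TwoForm n X} (hη : IsKahlerForm η) {φ : ℝ → SmoothFn n X}
    {ξ : Fin 3 → ℝ → SmoothFn n X} (hφ : IsSmoothCurve φ) (hξ : ∀ j, IsSmoothCurve (ξ j)) {t : ℝ}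
    (ht : φ t ∈ potentials η) : ContDiffAt ℝ ∞ (fun s => theta η (φ s) fun j => ξ j s) t := by
  refine (contDiff_chartIntegral (D := fun s => bracketDensity η (φ s) (ξ 0 s) (ξ 1 s) (ξ 2 s))
    fun c => contDiffOn_bracketDensity_param hη hφ (hξ 0) (hξ 1) (hξ 2)
      c).contDiffAt.congr_of_eventuallyEq ?_
  filter_upwards [eventually_nondeg hη hφ ht] with s hs
  exact theta_eq_chartIntegral hs _

/-- In a chart `ω_(φ + tψ)` is affine in `t` with slope `i∂∂̄ψ`, so differentiating under the
integral sign turns `dVol` into `ddVol`. -/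
theorem deriv_theta {η : TwoForm n X} (hη : IsKahlerForm η) {φ : SmoothFn n X}
    (hφ : φ ∈ potentials η) (ψ : SmoothFn n X) (ξ : Fin 3 → SmoothFn n X) :
    deriv (fun t : ℝ => theta η (φ + t • ψ) ξ) 0 =
      chartIntegral (variationDensity η φ ψ (ξ 0) (ξ 1) (ξ 2)) := by
  have hline := isSmoothCurve_line φ ψ
  have h1 := hasDerivAt_chartIntegral
    (D := fun s => bracketDensity η (φ + s • ψ) (ξ 0) (ξ 1) (ξ 2))
    (fun c => contDiffOn_bracketDensity_param hη hline (f := fun _ => ξ 0) (g := fun _ => ξ 1)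
      (h := fun _ => ξ 2) (isSmoothCurve_const _) (isSmoothCurve_const _)
      (isSmoothCurve_const _) c) 0
  have h2 : (fun t : ℝ => theta η (φ + t • ψ) ξ) =ᶠ[𝓝 0]
      fun s => chartIntegral (bracketDensity η (φ + s • ψ) (ξ 0) (ξ 1) (ξ 2)) := by
    filter_upwards [eventually_nondeg hη hline (t := 0) (by simpa using hφ)] with s hs
    exact theta_eq_chartIntegral hs _
  rw [h2.deriv_eq, h1.deriv]
  refine chartIntegral_congr fun c y hy => ?_
  have he := chart_mem_atlas (Cn n) c
  have hy := partitionSupport_subset c hy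
  simp only [bracketDensity, localForm_add_smul η φ ψ he hy, variationDensity]
  set W := localForm η φ (chartAt (Cn n) c) y
  set δ := iddbarCn (ψ ∘ (chartAt (Cn n) c).symm) y
  set ζ := wedge (fderiv ℝ (ξ 0 ∘ (chartAt (Cn n) c).symm) y)
    (fderiv ℝ (ξ 1 ∘ (chartAt (Cn n) c).symm) y)
  have h3 : HasDerivAt (fun t : ℝ => dVol n (W + t • δ)) (ddVol n (W + (0 : ℝ) • δ) δ) 0 :=
    (hasFDerivAt_dVol (W + (0 : ℝ) • δ)).comp_hasDerivAt (0 : ℝ) (hasDerivAt_add_smul W δ 0)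
  have h4 := (h3.clm_apply (hasDerivAt_const (0 : ℝ) ζ)).const_mul
    (ξ 2 ((chartAt (Cn n) c).symm y))
  rw [h4.deriv]
  simp

/-! ### Multilinearity -/

theorem chartIntegral_bracketDensity_swap_left (η : TwoForm n X) (φ f g h : SmoothFn n X) :
    chartIntegral (bracketDensity η φ f g h) = - chartIntegral (bracketDensity η φ g f h) := by
  rw [← neg_one_mul, ← chartIntegral_const_mul]
  congr 1
  funext c y
  rw [bracketDensity, wedge_swap, map_neg, bracketDensity]
  ring

theorem chartIntegral_bracketDensity_add {η : TwoForm n X} (hη : IsKahlerForm η)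
    (φ f g h h' : SmoothFn n X) : chartIntegral (bracketDensity η φ f g (h + h')) =
      chartIntegral (bracketDensity η φ f g h) + chartIntegral (bracketDensity η φ f g h') := by
  rw [← chartIntegral_add (continuousOn_bracketDensity hη φ f g h)
    (continuousOn_bracketDensity hη φ f g h')]
  congr 1
  funext c y
  exact add_mul _ _ _

theorem chartIntegral_bracketDensity_smul (η : TwoForm n X) (φ f g h : SmoothFn n X) (r : ℝ) :
    chartIntegral (bracketDensity η φ f g (r • h)) =
      r * chartIntegral (bracketDensity η φ f g h) := by
  rw [← chartIntegral_const_mul]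
  congr 1
  funext c y
  exact mul_assoc _ _ _

/-- Linearity is evident in the last argument, where no derivative falls; the skew symmetries carry
it to the other two. -/
theorem exists_alternatingMap_theta {η : TwoForm n X} (hη : IsKahlerForm η) {φ : SmoothFn n X}
    (hφ : φ ∈ potentials η) :
    ∃ A : SmoothFn n X [⋀^Fin 3]→ₗ[ℝ] ℝ, ∀ ξ, A ξ = theta η φ ξ := by
  set I : SmoothFn n X → SmoothFn n X → SmoothFn n X → ℝ :=
    fun f g h => chartIntegral (bracketDensity η φ f g h) with hI
  have hs12 : ∀ f g h, I f g h = - I g f h := chartIntegral_bracketDensity_swap_left η φ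
  have hs23 : ∀ f g h, I f g h = - I f h g := chartIntegral_bracketDensity_swap hη hφ
  have hs13 : ∀ f g h, I f g h = - I h g f := fun f g h => by
    rw [hs12, hs23, hs12 g h f, neg_neg]
  have ha3 : ∀ f g h h', I f g (h + h') = I f g h + I f g h' :=
    chartIntegral_bracketDensity_add hη φ
  have hm3 : ∀ f g h r, I f g (r • h) = r * I f g h := chartIntegral_bracketDensity_smul η φ
  have ha2 : ∀ f g g' h, I f (g + g') h = I f g h + I f g' h := fun f g g' h => by
    rw [hs23, ha3, neg_add, ← hs23, ← hs23]
  have hm2 : ∀ f g h r, I f (r • g) h = r * I f g h := fun f g h r => by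
    rw [hs23, hm3, ← mul_neg, ← hs23]
  have ha1 : ∀ f f' g h, I (f + f') g h = I f g h + I f' g h := fun f f' g h => by
    rw [hs12, ha2, neg_add, ← hs12, ← hs12]
  have hm1 : ∀ f g h r, I (r • f) g h = r * I f g h := fun f g h r => by
    rw [hs12, hm2, ← mul_neg, ← hs12]
  have h12 : ∀ f h, I f f h = 0 := fun f h => by linarith [hs12 f f h]
  have h23 : ∀ f h, I h f f = 0 := fun f h => by linarith [hs23 h f f]
  have h13 : ∀ f h, I f h f = 0 := fun f h => by linarith [hs13 f h f]
  refine ⟨{ toFun := fun ξ => I (ξ 0) (ξ 1) (ξ 2)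
            map_update_add' := ?_
            map_update_smul' := ?_
            map_eq_zero_of_eq' := ?_ }, fun ξ => (theta_of_mem_potentials hφ ξ).symm⟩
  · intro hdec v i x y
    obtain rfl : hdec = instDecidableEqFin 3 := Subsingleton.elim _ _
    fin_cases i <;> simp [ha1, ha2, ha3]
  · intro hdec v i r x
    obtain rfl : hdec = instDecidableEqFin 3 := Subsingleton.elim _ _
    fin_cases i <;> simp [hm1, hm2, hm3]
  · intro v i j hv hij
    fin_cases i <;> fin_cases j <;> simp at hij hv <;> simp [hv, h12, h23, h13]

theorem extDerivForm_theta {η : TwoForm n X} (hη : IsKahlerForm η) {φ : SmoothFn n X}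
    (hφ : φ ∈ potentials η) (ξ : Fin 4 → SmoothFn n X) : extDerivForm (theta η) φ ξ = 0 := by
  have key := alternating_sum_chartIntegral_variationDensity hη hφ ξ
  rw [extDerivForm, Fin.sum_univ_four]
  simp only [deriv_theta hη hφ]
  simp [Fin.succAbove]
  linarith

end Theta

end KahlerPotentials

end

theorem mainTheorem8 (n : ℕ) (X : Type*) [TopologicalSpace X] [T2Space X] [CompactSpace X]
    [ChartedSpace (KahlerPotentials.Cn n) X]
    [IsManifold 𝓘(ℂ, KahlerPotentials.Cn n) ω X]
    (η : KahlerPotentials.TwoForm n X) (hη : KahlerPotentials.IsKahlerForm η) :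
    KahlerPotentials.IsSmoothForm 3 (KahlerPotentials.potentials η) (KahlerPotentials.theta η) ∧
    ∀ φ ∈ KahlerPotentials.potentials η, ∀ ξ : Fin 4 → KahlerPotentials.SmoothFn n X,
      KahlerPotentials.extDerivForm (KahlerPotentials.theta η) φ ξ = 0 :=
  ⟨{ alternating := fun _ hφ => KahlerPotentials.exists_alternatingMap_theta hη hφ
     smooth := fun _ _ hc hξ _ ht => KahlerPotentials.contDiffAt_theta hη hc hξ ht },
    fun _ hφ ξ => KahlerPotentials.extDerivForm_theta hη hφ ξ⟩
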